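/- Let $n\ge 3$. A line segment in $\mathbb{R}^3$ may be closed, open or half-open, and may degenerate to a point; the segments of a collection may intersect or overlap. A transversal to a collection of segments is a line of $\mathbb{R}^3$ that meets every segment of the collection. The space of lines of $\mathbb{R}^3$ carries its usual topology (the quotient topology from pairs (point, nonzero direction vector), equivalently the topology given by Plücker coordinates). Two transversals lie in the same connected component if one can be moved continuously to the other while remaining a transversal; equivalently, if they lie in the same connected component of the set of transversals as a subspace of line space. (a) For any $n$ line segments in $\mathbb{R}^3$, the set of transversals either is finite with at most $n$ elements, or is infinite and has exactly $k$ connected components for some $1\le k\le n$ (and the two notions of component give the same number $k$). (b) For every $k\in\{0,1,\dots,n\}$ there are $n$ distinct line segments in $\mathbb{R}^3$ with exactly $k$ transversals. (c) For every $k\in\{1,\dots,n\}$ there are $n$ distinct line segments in $\mathbb{R}^3$ with infinitely many transversals forming exactly $k$ connected components. -/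

import Mathlib

/-- Euclidean three-space. -/
abbrev Space : Type := EuclideanSpace ℝ (Fin 3)

/-- The space of all (affine) lines of `ℝ³`. -/
def Line : Type :=
  {L : AffineSubspace ℝ Space // Module.finrank ℝ L.direction = 1}

/-- The set of points lying on a line. -/
def Line.points (ℓ : Line) : Set Space := (ℓ.1 : Set Space)

/-- The line through the point `p` with the nonzero direction vector `v`. -/
noncomputable def Line.through (x : Space × {v : Space // v ≠ 0}) : Line :=
  ⟨AffineSubspace.mk' x.1 (Submodule.span ℝ {x.2.1}), by
    rw [AffineSubspace.direction_mk']
    exact finrank_span_singleton x.2.2⟩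

/-- The usual topology of line space: the quotient topology of the parametrization of lines by a
point and a nonzero direction vector. It agrees with the topology induced by the Plücker
coordinates `(p, v) ↦ [v : p × v]`, because `p` can be replaced by the point
`v × (p × v) / ‖v‖²` of the same line, which depends continuously on these coordinates. -/
noncomputable instance Line.instTopologicalSpace : TopologicalSpace Line :=
  TopologicalSpace.coinduced Line.through inferInstance

/-- `S` is a line segment: closed, open, or half-open, and possibly reduced to a point.
(For `a = b` each of the three sets is `{a}`; a segment is never empty.) -/
def IsLineSegment (S : Set Space) : Prop :=
  ∃ a b : Space,
    S = segment ℝ a b ∨ S = openSegment ℝ a b ∨ S = insert a (openSegment ℝ a b)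

/-- The set of line transversals to a family of sets: the lines that meet every member. -/
def transversals {ι : Type} (s : ι → Set Space) : Set Line :=
  {ℓ | ∀ i, (ℓ.points ∩ s i).Nonempty}

/-- `T` has exactly `k` components, both in the sense that two lines are in the same component
when one can be moved continuously to the other inside `T` (path components), and in the sense of
the connected components of `T` as a subspace of line space. It is used only for `1 ≤ k`, where
`Nat.card _ = k` entails finiteness. -/
def HasComponents (T : Set Line) (k : ℕ) : Prop :=
  Nat.card (ZerothHomotopy T) = k ∧ Nat.card (ConnectedComponents T) = k

/-! The upper bound is proved in the form `CoveredByPieces T n`. A finite closed cover whose traces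
on `T` are joined inside `T` makes the path components clopen in `T`; hence the two notions of
component agree, there are at most `n` components, and a finite `T` has at most `n` points.

If all segments share a point, every transversal can be translated to that point and then rotated
about it, so the set is connected. If two segments lie on skew lines, affine coordinates turn these
lines into two fixed axes, and a transversal becomes a pair `(t, u)` of positions on the axes.
Eliminating the parameter on a segment gives one bilinear relation between `t` and `u` per segment.
When all relations are trivial, the set of pairs is convex. A nontrivial degenerate relation factors
and confines the pairs to a cross of two pencils. A nondegenerate relation is a hyperbola, that is,
a ruling of a quadric; a second, independent relation leaves at most two lines, and otherwise all
nontrivial relations are proportional. Along a pencil or a ruling, the meeting point with a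
segment's line can jump over the segment's complement only by passing through infinity, so one cut
per segment suffices. The two segments on the axes need no cut, and the bookkeeping gives `n` pieces
(`coveredByPieces_cross`, `coveredByPieces_hyperbola`). If no two segments are skew and no point is
common, all transversals lie in one plane (`exists_plane_of_coplanar`), where the directions of the
segments divide the directions of lines into at most `n` arcs (`coveredByPieces_plane`). The common
engine is `exists_affine_zero_combination`.

For sharpness, one segment on a line of a ruling of a hyperboloid restricts the parameter of the
opposite ruling to an interval, and `n - 1` long segments on further lines of that ruling each
remove one open gap. Touching gaps leave isolated points, smaller gaps leave intervals. -/

/-! ### Counting components by closed pieces -/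

/-- `T` is covered by at most `m` closed sets, each of which meets `T` in points that can be joined
inside `T`. -/
def CoveredByPieces {X : Type} [TopologicalSpace X] (T : Set X) (m : ℕ) : Prop :=
  ∃ (ι : Type) (_ : Fintype ι) (C : ι → Set X), Fintype.card ι ≤ m ∧ (∀ i, IsClosed (C i)) ∧
    (T ⊆ ⋃ i, C i) ∧ ∀ i, ∀ x ∈ T ∩ C i, ∀ y ∈ T ∩ C i, JoinedIn T x y

namespace CoveredByPieces

variable {X Y : Type} [TopologicalSpace X] [TopologicalSpace Y]

theorem mono {T : Set X} {m k : ℕ} (h : CoveredByPieces T m) (hmk : m ≤ k) :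
    CoveredByPieces T k := by
  obtain ⟨ι, _, C, hc, h1, h2, h3⟩ := h
  exact ⟨ι, _, C, hc.trans hmk, h1, h2, h3⟩

theorem of_joinedIn {T : Set X} (h : ∀ x ∈ T, ∀ y ∈ T, JoinedIn T x y) : CoveredByPieces T 1 :=
  ⟨Unit, inferInstance, fun _ => Set.univ, by simp, fun _ => isClosed_univ,
    fun x _ => Set.mem_iUnion.2 ⟨(), Set.mem_univ x⟩, fun _ x hx y hy => h x hx.1 y hy.1⟩

theorem of_finite [T1Space X] {T : Set X} {m : ℕ} (hT : T.Finite) (hm : T.ncard ≤ m) :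
    CoveredByPieces T m := by
  have := hT.fintype
  refine ⟨T, this, fun x => {x.1}, ?_, fun _ => isClosed_singleton, ?_, ?_⟩
  · rwa [← Nat.card_eq_fintype_card, Nat.card_coe_set_eq]
  · intro x hx
    exact Set.mem_iUnion.2 ⟨⟨x, hx⟩, rfl⟩
  · rintro i x ⟨hx, hx'⟩ y ⟨hy, hy'⟩
    obtain rfl : x = i.1 := hx'
    obtain rfl : y = i.1 := hy'
    exact JoinedIn.refl hx

theorem union {T D₁ D₂ : Set X} {m₁ m₂ : ℕ} (h₁ : IsClosed D₁) (h₂ : IsClosed D₂)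
    (hT : T ⊆ D₁ ∪ D₂) (c₁ : CoveredByPieces (T ∩ D₁) m₁) (c₂ : CoveredByPieces (T ∩ D₂) m₂) :
    CoveredByPieces T (m₁ + m₂) := by
  obtain ⟨ι, _, C, hc, h1, h2, h3⟩ := c₁
  obtain ⟨ι', _, C', hc', h1', h2', h3'⟩ := c₂
  -- Each piece is cut down to its own `D`, because it controls only the points of `T` in that set.
  refine ⟨ι ⊕ ι', inferInstance, Sum.elim (fun i => D₁ ∩ C i) (fun i => D₂ ∩ C' i), ?_, ?_, ?_, ?_⟩
  · rw [Fintype.card_sum]; omega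
  · rintro (i | i)
    · exact h₁.inter (h1 i)
    · exact h₂.inter (h1' i)
  · intro x hx
    rcases hT hx with hx' | hx'
    · obtain ⟨i, hi⟩ := Set.mem_iUnion.1 (h2 ⟨hx, hx'⟩)
      exact Set.mem_iUnion.2 ⟨Sum.inl i, hx', hi⟩
    · obtain ⟨i, hi⟩ := Set.mem_iUnion.1 (h2' ⟨hx, hx'⟩)
      exact Set.mem_iUnion.2 ⟨Sum.inr i, hx', hi⟩
  · rintro (i | i) x ⟨hx, hx', hxi⟩ y ⟨hy, hy', hyi⟩
    · exact (h3 i x ⟨⟨hx, hx'⟩, hxi⟩ y ⟨⟨hy, hy'⟩, hyi⟩).mono Set.inter_subset_left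
    · exact (h3' i x ⟨⟨hx, hx'⟩, hxi⟩ y ⟨⟨hy, hy'⟩, hyi⟩).mono Set.inter_subset_left

/-- Transfer along a map with a continuous left inverse. -/
theorem image {S : Set Y} {m : ℕ} (h : CoveredByPieces S m) {f : Y → X} {g : X → Y}
    (hf : ContinuousOn f S) (hg : ContinuousOn g (f '' S)) (hgf : ∀ s ∈ S, g (f s) = s) :
    CoveredByPieces (f '' S) m := by
  obtain ⟨ι, _, C, hc, h1, h2, h3⟩ := h
  have key := fun i => continuousOn_iff_isClosed.1 hg (C i) (h1 i)
  choose u hu hu' using key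
  have mem : ∀ i, ∀ s ∈ S, f s ∈ u i ↔ s ∈ C i := by
    intro i s hs
    have h : f s ∈ g ⁻¹' C i ∩ f '' S ↔ f s ∈ u i ∩ f '' S := by rw [hu']
    have hm : f s ∈ f '' S := ⟨s, hs, rfl⟩
    simpa [hm, hgf s hs] using h.symm
  refine ⟨ι, _, u, hc, hu, ?_, ?_⟩
  · rintro _ ⟨s, hs, rfl⟩
    obtain ⟨i, hi⟩ := Set.mem_iUnion.1 (h2 hs)
    exact Set.mem_iUnion.2 ⟨i, (mem i s hs).2 hi⟩
  · rintro i _ ⟨⟨s, hs, rfl⟩, hsi⟩ _ ⟨⟨s', hs', rfl⟩, hsi'⟩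
    have := h3 i s ⟨hs, (mem i s hs).1 hsi⟩ s' ⟨hs', (mem i s' hs').1 hsi'⟩
    exact this.map_continuousOn hf

/-- Since a piece never meets two path components, a path component and its complement are both
finite unions of traces of closed pieces. -/
theorem isClopen_pathComponent {T : Set X} {m : ℕ} (h : CoveredByPieces T m) (x : T) :
    IsClopen (pathComponent x) := by
  obtain ⟨ι, _, C, hc, h1, h2, h3⟩ := h
  have hjoin : ∀ i (a b : T), a.1 ∈ C i → b.1 ∈ C i → Joined a b := fun i a b ha hb =>
    (joinedIn_iff_joined a.2 b.2).1 (h3 i a ⟨a.2, ha⟩ b ⟨b.2, hb⟩)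
  have hcl : ∀ y : T, IsClosed (pathComponent y) := by
    intro y
    have : pathComponent y = ⋃ i ∈ {i | ∃ z : T, z.1 ∈ C i ∧ Joined y z},
        ((↑) : T → X) ⁻¹' C i := by
      ext z
      simp only [Set.mem_iUnion, Set.mem_preimage, Set.mem_ofPred_eq, exists_prop]
      constructor
      · intro hz
        obtain ⟨i, hi⟩ := Set.mem_iUnion.1 (h2 z.2)
        exact ⟨i, ⟨z, hi, hz⟩, hi⟩
      · rintro ⟨i, ⟨w, hw, hyw⟩, hz⟩
        exact hyw.trans (hjoin i w z hw hz)
    rw [this]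
    exact Set.Finite.isClosed_biUnion (Set.toFinite _)
      fun i _ => (h1 i).preimage continuous_subtype_val
  refine ⟨hcl x, ?_⟩
  have : (pathComponent x)ᶜ = ⋃ i ∈ {i | ∃ z : T, z.1 ∈ C i ∧ ¬ Joined x z},
      ((↑) : T → X) ⁻¹' C i := by
    ext z
    simp only [Set.mem_iUnion, Set.mem_preimage, Set.mem_ofPred_eq, exists_prop, Set.mem_compl_iff]
    constructor
    · intro hz
      obtain ⟨i, hi⟩ := Set.mem_iUnion.1 (h2 z.2)
      exact ⟨i, ⟨z, hi, hz⟩, hi⟩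
    · rintro ⟨i, ⟨w, hw, hyw⟩, hz⟩ hxz
      exact hyw (Joined.trans hxz (hjoin i z w hz hw))
  rw [← isClosed_compl_iff, this]
  exact Set.Finite.isClosed_biUnion (Set.toFinite _)
    fun i _ => (h1 i).preimage continuous_subtype_val

theorem card_connectedComponents {T : Set X} {m : ℕ} (h : CoveredByPieces T m) :
    Nat.card (ConnectedComponents T) = Nat.card (ZerothHomotopy T) := by
  symm
  have hle : ∀ x y : T, Joined x y → (x : ConnectedComponents T) = y := by
    intro x y hxy
    rw [ConnectedComponents.coe_eq_coe']
    exact pathComponent_subset_component y hxy.symm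
  refine Nat.card_congr (Equiv.ofBijective
    (Quotient.lift (fun x : T => (x : ConnectedComponents T)) hle) ⟨?_, ?_⟩)
  · rintro ⟨x⟩ ⟨y⟩ hxy
    apply Quotient.sound
    have hxy' : (x : ConnectedComponents T) = y := hxy
    rw [ConnectedComponents.coe_eq_coe'] at hxy'
    have := (h.isClopen_pathComponent y).connectedComponent_subset (mem_pathComponent_self y) hxy'
    exact Joined.symm this
  · intro c
    obtain ⟨x, rfl⟩ := ConnectedComponents.surjective_coe c
    exact ⟨Quotient.mk _ x, rfl⟩

theorem card_zerothHomotopy {T : Set X} {m : ℕ} (h : CoveredByPieces T m) :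
    Finite (ZerothHomotopy T) ∧ Nat.card (ZerothHomotopy T) ≤ m := by
  obtain ⟨ι, _, C, hc, h1, h2, h3⟩ := h
  have hex : ∀ c : ZerothHomotopy T, ∃ i, ∃ x : T, x.1 ∈ C i ∧ Quotient.mk _ x = c := by
    rintro ⟨x⟩
    obtain ⟨i, hi⟩ := Set.mem_iUnion.1 (h2 x.2)
    exact ⟨i, x, hi, rfl⟩
  choose i x hx hxc using hex
  have hinj : Function.Injective i := by
    intro c d hcd
    rw [← hxc c, ← hxc d]
    apply Quotient.sound
    exact (joinedIn_iff_joined (x c).2 (x d).2).1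
      (h3 (i c) _ ⟨(x c).2, hx c⟩ _ ⟨(x d).2, hcd ▸ hx d⟩)
  refine ⟨Finite.of_injective i hinj, ?_⟩
  calc _ ≤ Nat.card ι := Nat.card_le_card_of_injective i hinj
    _ ≤ m := by rwa [Nat.card_eq_fintype_card]

/-- A finite T₁ space is discrete, so its points are its connected components. -/
theorem ncard_le_of_finite [T1Space X] {T : Set X} {m : ℕ} (h : CoveredByPieces T m)
    (hT : T.Finite) : T.ncard ≤ m := by
  have := hT.to_subtype
  have := h.card_zerothHomotopy
  rw [← h.card_connectedComponents] at this
  have hinj : Function.Injective (fun x : T => (x : ConnectedComponents T)) := by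
    intro x y hxy
    have hxy' : (x : ConnectedComponents T) = y := hxy
    rw [ConnectedComponents.coe_eq_coe'] at hxy'
    have : DiscreteTopology T := inferInstance
    simpa using hxy'
  have hf : Finite (ConnectedComponents T) := inferInstance
  rw [← Nat.card_coe_set_eq]
  exact (Nat.card_le_card_of_injective _ hinj).trans this.2

end CoveredByPieces

theorem CoveredByPieces.finite_or_hasComponents [T1Space Line] {T : Set Line} {n : ℕ}
    (h : CoveredByPieces T n) :
    (T.Finite ∧ T.ncard ≤ n) ∨
      (T.Infinite ∧ ∃ k : ℕ, 1 ≤ k ∧ k ≤ n ∧ HasComponents T k) := by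
  by_cases hT : T.Finite
  · exact Or.inl ⟨hT, h.ncard_le_of_finite hT⟩
  · refine Or.inr ⟨hT, Nat.card (ZerothHomotopy T), ?_, h.card_zerothHomotopy.2, rfl,
      h.card_connectedComponents⟩
    have := h.card_zerothHomotopy.1
    obtain ⟨x, hx⟩ := Set.Infinite.nonempty hT
    have : Nonempty (ZerothHomotopy T) := ⟨Quotient.mk _ ⟨x, hx⟩⟩
    exact Nat.card_pos

/-- A continuous surjection onto `k` points with path-connected fibres counts the components. -/
theorem card_components_of_fibers {X : Type} [TopologicalSpace X] {k : ℕ} (r : X → Fin k)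
    (hr : Continuous r) (hs : Function.Surjective r) (hj : ∀ x y, r x = r y → Joined x y) :
    Nat.card (ZerothHomotopy X) = k ∧ Nat.card (ConnectedComponents X) = k := by
  have hconn : ∀ x y : X, (x : ConnectedComponents X) = y → r x = r y := by
    intro x y hxy
    rw [ConnectedComponents.coe_eq_coe'] at hxy
    have : IsPreconnected (r '' connectedComponent y) :=
      isPreconnected_connectedComponent.image r hr.continuousOn
    exact this.subsingleton ⟨x, hxy, rfl⟩ ⟨y, mem_connectedComponent, rfl⟩
  have hpath : ∀ x y : X, Joined x y → (x : ConnectedComponents X) = y := by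
    intro x y hxy
    rw [ConnectedComponents.coe_eq_coe']
    exact pathComponent_subset_component y hxy.symm
  constructor
  · rw [← Nat.card_fin k]
    refine Nat.card_congr (Equiv.ofBijective
      (Quotient.lift r (fun x y h => hconn x y (hpath x y h))) ⟨?_, ?_⟩)
    · rintro ⟨x⟩ ⟨y⟩ hxy
      exact Quotient.sound (hj x y hxy)
    · intro i
      obtain ⟨x, rfl⟩ := hs i
      exact ⟨Quotient.mk _ x, rfl⟩
  · rw [← Nat.card_fin k]
    refine Nat.card_congr (Equiv.ofBijective
      (Quotient.lift (s := connectedComponentSetoid X) r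
        (fun x y h => hconn x y (Quotient.sound (s := connectedComponentSetoid X) h))) ⟨?_, ?_⟩)
    · rintro ⟨x⟩ ⟨y⟩ hxy
      exact hpath x y (hj x y hxy)
    · intro i
      obtain ⟨x, rfl⟩ := hs i
      exact ⟨Quotient.mk (connectedComponentSetoid X) x, rfl⟩

/-! ### Cuts of the real line and sign conditions -/

/-- A set of reals which is order-convex between the points of `F` splits into `#F + 1` pieces. -/
theorem CoveredByPieces.of_cuts {K : Set ℝ} (F : Finset ℝ)
    (h : ∀ x ∈ K, ∀ y ∈ K, x ≤ y → (∀ f ∈ F, ¬ (x < f ∧ f < y)) →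
      ∀ w w' : ℝ, 0 ≤ w → 0 ≤ w' → w + w' = 1 → w * x + w' * y ∈ K) :
    CoveredByPieces K (F.card + 1) := by
  have hIcc : ∀ x ∈ K, ∀ y ∈ K, x ≤ y → (∀ f ∈ F, ¬ (x < f ∧ f < y)) → JoinedIn K x y := by
    intro x hx y hy hxy hF
    have hsub : segment ℝ x y ⊆ K := by
      rintro _ ⟨w, w', hw, hw', hww, rfl⟩
      exact h x hx y hy hxy hF w w' hw hw' hww
    exact (((convex_segment x y).isPathConnected ⟨x, left_mem_segment ℝ x y⟩).joinedIn x
      (left_mem_segment ℝ x y) y (right_mem_segment ℝ x y)).mono hsub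
  have hjoin : ∀ x ∈ K, ∀ y ∈ K, (∀ f ∈ F, (f ≤ x ∧ f ≤ y) ∨ (x ≤ f ∧ y ≤ f)) →
      JoinedIn K x y := by
    intro x hx y hy hF
    rcases le_total x y with hxy | hxy
    · refine hIcc x hx y hy hxy fun f hf hlt => ?_
      rcases hF f hf with hh | hh <;> linarith [hh.1, hh.2, hlt.1, hlt.2]
    · refine (hIcc y hy x hx hxy fun f hf hlt => ?_).symm
      rcases hF f hf with hh | hh <;> linarith [hh.1, hh.2, hlt.1, hlt.2]
  -- The piece of `f` runs from the preceding cut up to `f`, and `none` is the ray above all cuts.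
  -- Endpoints are included, so the pieces are closed.
  refine ⟨Option F, inferInstance, fun o => o.elim {x | ∀ g ∈ F, g ≤ x}
    (fun f => {x | x ≤ f.1 ∧ ∀ g ∈ F, g < f.1 → g ≤ x}), by simp, ?_, ?_, ?_⟩
  · rintro (_ | f)
    · simp only [Option.elim, Set.ofPred_forall]
      exact isClosed_biInter fun g _ => isClosed_Ici
    · simp only [Option.elim, Set.ofPred_and, Set.ofPred_forall]
      exact isClosed_Iic.inter (isClosed_iInter fun g => isClosed_iInter fun _ =>
        isClosed_iInter fun _ => isClosed_Ici)
  · intro x _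
    by_cases hx : ∀ g ∈ F, g ≤ x
    · exact Set.mem_iUnion.2 ⟨none, hx⟩
    · push Not at hx
      obtain ⟨g, hg, hgx⟩ := hx
      have hne : (F.filter (x ≤ ·)).Nonempty := ⟨g, by simp [hg, hgx.le]⟩
      obtain ⟨f, hf, hmin⟩ := Finset.exists_min_image _ id hne
      simp only [Finset.mem_filter, id] at hf hmin
      refine Set.mem_iUnion.2 ⟨some ⟨f, hf.1⟩, hf.2, fun g' hg' hlt => ?_⟩
      by_contra! hcon
      linarith [hmin g' ⟨hg', hcon.le⟩]
  · rintro (_ | f) x ⟨hx, hx'⟩ y ⟨hy, hy'⟩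
    · exact hjoin x hx y hy fun f hf => Or.inl ⟨hx' f hf, hy' f hf⟩
    · refine hjoin x hx y hy fun g hg => ?_
      rcases lt_or_ge g f.1 with hlt | hge
      · exact Or.inl ⟨hx'.2 g hg hlt, hy'.2 g hg hlt⟩
      · exact Or.inr ⟨hx'.1.trans hge, hy'.1.trans hge⟩

/-- Weighted combinations preserve the vanishing of an affine function, with values `A` and `B` at
`0` and `1`, on a convex set, as long as the slope does not change its sign. -/
theorem exists_affine_zero_combination {J : Set ℝ} (hJ : Convex ℝ J) {A B A' B' : ℝ}
    (hs : 0 ≤ (A - B) * (A' - B')) (h : ∃ s ∈ J, (1 - s) * A + s * B = 0)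
    (h' : ∃ s ∈ J, (1 - s) * A' + s * B' = 0) {w w' : ℝ} (hw : 0 ≤ w) (hw' : 0 ≤ w') :
    ∃ s ∈ J, (1 - s) * (w * A + w' * A') + s * (w * B + w' * B') = 0 := by
  obtain ⟨s, hsJ, e⟩ := h
  obtain ⟨s', hsJ', e'⟩ := h'
  set D := A - B with hD
  set D' := A' - B' with hD'
  have hA : A = s * D := by rw [hD]; linarith
  have hA' : A' = s' * D' := by rw [hD']; linarith
  have hB : B = s * D - D := by rw [← hA, hD]; ring
  have hB' : B' = s' * D' - D' := by rw [← hA', hD']; ring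
  -- The zeros are combined with weights proportional to `w * D` and `w' * D'`, which have the same
  -- sign. If their sum vanishes, both vanish, and the old zero `s` still works.
  by_cases h0 : w * D + w' * D' = 0
  · have h1 : w * D = 0 ∧ w' * D' = 0 := by
      have hp : 0 ≤ (w * D) * (w' * D') := by
        have := mul_nonneg (mul_nonneg hw hw') hs
        nlinarith
      constructor <;> nlinarith [sq_nonneg (w * D), sq_nonneg (w' * D')]
    refine ⟨s, hsJ, ?_⟩
    rw [hA, hA', hB, hB']
    linear_combination (0 : ℝ) * h1.1 + (s' - s) * h1.2
  · refine ⟨(w * D / (w * D + w' * D')) * s + (w' * D' / (w * D + w' * D')) * s', ?_, ?_⟩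
    · have hnn : 0 ≤ (w * D) * (w * D + w' * D') := by
        have := mul_nonneg (mul_nonneg hw hw') hs
        nlinarith [sq_nonneg (w * D)]
      have hnn' : 0 ≤ (w' * D') * (w * D + w' * D') := by
        have := mul_nonneg (mul_nonneg hw hw') hs
        nlinarith [sq_nonneg (w' * D')]
      have hdiv : ∀ a b : ℝ, 0 ≤ a * b → 0 ≤ a / b := by
        intro a b hab
        rcases eq_or_ne b 0 with rfl | hb
        · simp
        · have : a / b = a * b / (b * b) := by field_simp
          rw [this]
          exact div_nonneg hab (mul_self_nonneg b)
      exact hJ hsJ hsJ' (hdiv _ _ hnn) (hdiv _ _ hnn') (by field_simp)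
    · rw [hA, hA', hB, hB']
      field_simp
      ring

/-- An affine function changes sign only at its root. This turns "no cut between `x` and `y`" into
the slope condition of `exists_affine_zero_combination`. -/
theorem affine_mul_nonneg {a b x y : ℝ} (h : b ≠ 0 → ¬ (x < -a / b ∧ -a / b < y)) (hxy : x ≤ y) :
    0 ≤ (a + b * x) * (a + b * y) := by
  rcases eq_or_ne b 0 with rfl | hb
  · nlinarith [mul_self_nonneg a]
  · have e : ∀ z, a + b * z = b * (z - -a / b) := fun z => by field_simp; ring
    rw [e, e]
    have hb2 := mul_self_nonneg b
    have : 0 ≤ (x - -a / b) * (y - -a / b) := by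
      by_cases hx : x < -a / b
      · have : y ≤ -a / b := not_lt.1 fun hy => h hb ⟨hx, hy⟩
        nlinarith
      · nlinarith
    nlinarith

/-! ### Transversals in the coordinates of two skew lines -/

/-- Two coordinates `(t, u)` of the lines through `(t, 0, 0)` and `(0, u, 1)` that meet all of the
point sets `(1 - s) (xa, ya, za) + s (xb, yb, zb)`, `s ∈ J`. -/
def transversalCoords {ι : Type} (J : ι → Set ℝ) (xa xb ya yb za zb : ι → ℝ) : Set (ℝ × ℝ) :=
  {p | ∀ i, ∃ s ∈ J i, (1 - s) * (xa i - (1 - za i) * p.1) + s * (xb i - (1 - zb i) * p.1) = 0 ∧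
    (1 - s) * (ya i - za i * p.2) + s * (yb i - zb i * p.2) = 0}

/-- The condition on a pencil of transversals: cuts are needed only for the segments in the plane
of the pencil that are not collinear with the point of `u₀`. -/
theorem coveredByPieces_pencil {ι : Type} [Fintype ι] {J : ι → Set ℝ} (hJ : ∀ i, Convex ℝ (J i))
    (A B ya yb za zb : ι → ℝ) (u₀ : ℝ) (I : Finset ι)
    (hI : ∀ i, A i = 0 → B i = 0 → ¬ (ya i - za i * u₀ = 0 ∧ yb i - zb i * u₀ = 0) →
      za i ≠ zb i → i ∈ I) :
    CoveredByPieces {u : ℝ | ∀ i, ∃ s ∈ J i, (1 - s) * A i + s * B i = 0 ∧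
      (1 - s) * (ya i - za i * u) + s * (yb i - zb i * u) = 0} (I.card + 1) := by
  classical
  let F : Finset ℝ := I.image fun i => -(ya i - yb i) / -(za i - zb i)
  refine (CoveredByPieces.of_cuts F ?_).mono (Nat.succ_le_succ Finset.card_image_le)
  intro x hx y hy hxy hF w w' hw hw' hww i
  have hlin : ∀ a z : ℝ, a - z * (w * x + w' * y) = w * (a - z * x) + w' * (a - z * y) := by
    intro a z
    linear_combination (-a) * hww
  simp only [hlin]
  obtain ⟨s, hs, e1, e2⟩ := hx i
  obtain ⟨s', hs', e1', e2'⟩ := hy i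
  by_cases hAB : A i = 0 ∧ B i = 0
  · simp only [hAB.1, hAB.2, mul_zero, add_zero, true_and]
    by_cases h0 : ya i - za i * u₀ = 0 ∧ yb i - zb i * u₀ = 0
    · have hya : ya i = za i * u₀ := by linarith [h0.1]
      have hyb : yb i = zb i * u₀ := by linarith [h0.2]
      rw [hya, hyb] at e2 e2' ⊢
      have f : ((1 - s) * za i + s * zb i) * (u₀ - x) = 0 := by linarith
      have f' : ((1 - s') * za i + s' * zb i) * (u₀ - y) = 0 := by linarith
      rcases mul_eq_zero.1 f with f | f
      -- This point of the segment has height zero, so it is the centre of the pencil and lies on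
      -- every line of it. If neither line uses such a point, both parameters equal `u₀`.
      · refine ⟨s, hs, ?_⟩
        linear_combination (w * (u₀ - x) + w' * (u₀ - y)) * f
      · rcases mul_eq_zero.1 f' with f' | f'
        · refine ⟨s', hs', ?_⟩
          linear_combination (w * (u₀ - x) + w' * (u₀ - y)) * f'
        · refine ⟨s, hs, ?_⟩
          linear_combination ((1 - s) * za i + s * zb i) * (w * f + w' * f')
    · refine exists_affine_zero_combination (hJ i) ?_ ⟨s, hs, e2⟩ ⟨s', hs', e2'⟩ hw hw'
      have := affine_mul_nonneg (a := ya i - yb i) (b := -(za i - zb i)) (x := x) (y := y) ?_ hxy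
      · convert this using 2 <;> ring
      · intro hz
        exact hF _ (Finset.mem_image_of_mem _ (hI i hAB.1 hAB.2 h0
          fun h => hz (by rw [h]; ring)))
  -- A segment whose line is not in the plane of the pencil has at most one point there, so the same
  -- `s` serves both lines and the remaining condition is affine in `u`.
  · have hss : s = s' := by
      by_contra hne
      have h1 : (s - s') * (A i - B i) = 0 := by linarith
      have h2 : A i = B i := by
        rcases mul_eq_zero.1 h1 with h | h
        · exact absurd (sub_eq_zero.1 h) hne
        · linarith
      rw [h2] at e1
      exact hAB ⟨by linarith, by linarith⟩
    subst hss
    refine ⟨s, hs, e1, ?_⟩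
    linear_combination w * e2 + w' * e2'

/-- The two axis segments have constant height and need no cut. The two units saved pay for the
extra piece of each pencil of a cross, or for the pole and the extra piece of a hyperbola. -/
theorem card_filter_add_two_le {ι : Type} [Fintype ι] {za zb : ι → ℝ}
    {i₁ i₂ : ι} (h₁ : za i₁ = 0 ∧ zb i₁ = 0) (h₂ : za i₂ = 1 ∧ zb i₂ = 1) (I : Finset ι)
    (hI : ∀ i ∈ I, za i ≠ zb i) : I.card + 2 ≤ Fintype.card ι := by
  classical
  have hne : i₁ ≠ i₂ := by
    rintro rfl
    linarith [h₁.1, h₂.1]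
  have hsub : I ⊆ Finset.univ \ {i₁, i₂} := by
    intro i hi
    simp only [Finset.mem_sdiff, Finset.mem_univ, true_and, Finset.mem_insert,
      Finset.mem_singleton, not_or]
    constructor
    · rintro rfl
      exact hI _ hi (by rw [h₁.1, h₁.2])
    · rintro rfl
      exact hI _ hi (by rw [h₂.1, h₂.2])
  have h := Finset.card_le_card hsub
  rw [Finset.card_sdiff_of_subset (Finset.subset_univ _), Finset.card_pair hne,
    Finset.card_univ] at h
  have : ({i₁, i₂} : Finset ι).card ≤ Fintype.card ι := Finset.card_le_univ _
  rw [Finset.card_pair hne] at this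
  omega

section

variable {ι : Type} {J : ι → Set ℝ} {xa xb ya yb za zb : ι → ℝ} {i₁ i₂ : ι}

/-- A segment that needs a cut in one pencil lies in the plane of that pencil and is not collinear
with the line common to both, so it needs none in the other. The two sets of cuts are therefore
disjoint, with at most `n - 2` elements together. -/
theorem coveredByPieces_cross [Fintype ι] (hJ : ∀ i, Convex ℝ (J i))
    (h₁ : za i₁ = 0 ∧ zb i₁ = 0) (h₂ : za i₂ = 1 ∧ zb i₂ = 1) (t₀ u₀ : ℝ)
    (hS : ∀ p ∈ transversalCoords J xa xb ya yb za zb, p.1 = t₀ ∨ p.2 = u₀) :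
    CoveredByPieces (transversalCoords J xa xb ya yb za zb) (Fintype.card ι) := by
  classical
  set S := transversalCoords J xa xb ya yb za zb with hSdef
  let P : ι → Prop := fun i => xa i - (1 - za i) * t₀ = 0 ∧ xb i - (1 - zb i) * t₀ = 0
  let Q : ι → Prop := fun i => ya i - za i * u₀ = 0 ∧ yb i - zb i * u₀ = 0
  let Iv : Finset ι := Finset.univ.filter fun i => za i ≠ zb i ∧ P i ∧ ¬ Q i
  let Ih : Finset ι := Finset.univ.filter fun i => za i ≠ zb i ∧ Q i ∧ ¬ P i
  have hdisj : Disjoint Iv Ih := by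
    rw [Finset.disjoint_left]
    intro i hi hi'
    simp only [Iv, Ih, Finset.mem_filter] at hi hi'
    exact hi.2.2.2 hi'.2.2.1
  have hcard := card_filter_add_two_le h₁ h₂ (Iv ∪ Ih) (by
    intro i hi
    simp only [Finset.mem_union, Iv, Ih, Finset.mem_filter] at hi
    rcases hi with h | h <;> exact h.2.1)
  rw [Finset.card_union_of_disjoint hdisj] at hcard
  have cv := coveredByPieces_pencil hJ (fun i => xa i - (1 - za i) * t₀)
    (fun i => xb i - (1 - zb i) * t₀) ya yb za zb u₀ Iv (by
      intro i hA hB hQ hz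
      simp only [Iv, Finset.mem_filter, Finset.mem_univ, true_and]
      exact ⟨hz, ⟨hA, hB⟩, hQ⟩)
  -- The second pencil is the first one after exchanging the axes, which replaces `z` by `1 - z`.
  have ch := coveredByPieces_pencil hJ (fun i => ya i - za i * u₀)
    (fun i => yb i - zb i * u₀) xa xb (fun i => 1 - za i) (fun i => 1 - zb i) t₀ Ih (by
      intro i hA hB hQ hz
      simp only [Ih, Finset.mem_filter, Finset.mem_univ, true_and]
      exact ⟨fun h => hz (by rw [h]), ⟨hA, hB⟩, hQ⟩)
  have cv' := cv.image (f := fun u => (t₀, u)) (g := Prod.snd) (by fun_prop) (by fun_prop)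
    (fun _ _ => rfl)
  have ch' := ch.image (f := fun t => (t, u₀)) (g := Prod.fst) (by fun_prop) (by fun_prop)
    (fun _ _ => rfl)
  have hcov := CoveredByPieces.union (T := S) (D₁ := {p | p.1 = t₀}) (D₂ := {p | p.2 = u₀})
    (isClosed_eq continuous_fst continuous_const) (isClosed_eq continuous_snd continuous_const)
    (fun p hp => hS p hp) (m₁ := Iv.card + 1) (m₂ := Ih.card + 1) ?_ ?_
  · exact hcov.mono (by omega)
  · convert cv' using 1
    ext ⟨t, u⟩
    simp only [hSdef, transversalCoords, Set.mem_inter_iff, Set.mem_ofPred_eq, Set.mem_image,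
      Prod.mk.injEq]
    constructor
    · rintro ⟨h, rfl⟩
      exact ⟨u, h, rfl, rfl⟩
    · rintro ⟨u', h, rfl, rfl⟩
      exact ⟨h, rfl⟩
  · convert ch' using 1
    ext ⟨t, u⟩
    simp only [hSdef, transversalCoords, Set.mem_inter_iff, Set.mem_ofPred_eq, Set.mem_image,
      Prod.mk.injEq]
    constructor
    · rintro ⟨h, rfl⟩
      exact ⟨t, fun i => (h i).imp fun s hs => ⟨hs.1, hs.2.symm⟩, rfl, rfl⟩
    · rintro ⟨u', h, rfl, rfl⟩
      exact ⟨fun i => (h i).imp fun s hs => ⟨hs.1, hs.2.symm⟩, rfl⟩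

/-- Segments that impose no bilinear relation on `(t, u)`. -/
theorem trivial_relation_cases {xa xb ya yb za zb : ℝ} (h1 : zb - za = 0)
    (h2 : -(1 - za) * yb + (1 - zb) * ya = 0) (h3 : -xa * zb + xb * za = 0)
    (h4 : xa * yb - xb * ya = 0) :
    (xa = 0 ∧ xb = 0 ∧ za = 1 ∧ zb = 1) ∨ (ya = 0 ∧ yb = 0 ∧ za = 0 ∧ zb = 0) ∨
      (xa = xb ∧ ya = yb ∧ za = zb) := by
  obtain rfl : zb = za := by linarith
  by_cases h0 : zb = 0
  · subst h0
    have hy : ya = yb := by linarith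
    subst hy
    have : (xa - xb) * ya = 0 := by linarith
    rcases mul_eq_zero.1 this with h | h
    · exact Or.inr (Or.inr ⟨by linarith, rfl, rfl⟩)
    · exact Or.inr (Or.inl ⟨h, h, rfl, rfl⟩)
  · have hx : xa = xb := by
      have : (xb - xa) * zb = 0 := by linarith
      rcases mul_eq_zero.1 this with h | h
      · linarith
      · exact absurd h h0
    subst hx
    by_cases h1 : zb = 1
    · subst h1
      have : (yb - ya) * xa = 0 := by linarith
      rcases mul_eq_zero.1 this with h | h
      · exact Or.inr (Or.inr ⟨rfl, by linarith, rfl⟩)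
      · exact Or.inl ⟨h, h, rfl, rfl⟩
    · have : (1 - zb) * (ya - yb) = 0 := by linarith
      rcases mul_eq_zero.1 this with h | h
      · exact absurd (by linarith) h1
      · exact Or.inr (Or.inr ⟨rfl, by linarith, rfl⟩)

/-- The two equations say that the nonzero vector `(1 - s, s)` is in the kernel of a `2 × 2` matrix;
the relation is the vanishing of its determinant. -/
theorem bilinear_relation {J : Set ℝ} {xa xb ya yb za zb t u : ℝ}
    (h : ∃ s ∈ J, (1 - s) * (xa - (1 - za) * t) + s * (xb - (1 - zb) * t) = 0 ∧
      (1 - s) * (ya - za * u) + s * (yb - zb * u) = 0) :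
    (zb - za) * (t * u) + (-(1 - za) * yb + (1 - zb) * ya) * t + (-xa * zb + xb * za) * u +
      (xa * yb - xb * ya) = 0 := by
  obtain ⟨s, -, e1, e2⟩ := h
  by_cases hs : s = 0
  · subst hs
    linear_combination (yb - zb * u) * e1 - (xb - (1 - zb) * t) * e2
  · have : s * ((zb - za) * (t * u) + (-(1 - za) * yb + (1 - zb) * ya) * t +
        (-xa * zb + xb * za) * u + (xa * yb - xb * ya)) = 0 := by
      linear_combination (xa - (1 - za) * t) * e2 - (ya - za * u) * e1
    exact (mul_eq_zero.1 this).resolve_left hs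

/-- The set is convex: a segment on an axis gives one equation whose slope in `s` is constant, and a
single point gives two affine equations with a fixed `s`. -/
theorem coveredByPieces_of_trivial_relations (hJ : ∀ i, Convex ℝ (J i))
    (h : ∀ i, (xa i = 0 ∧ xb i = 0 ∧ za i = 1 ∧ zb i = 1) ∨
      (ya i = 0 ∧ yb i = 0 ∧ za i = 0 ∧ zb i = 0) ∨ (xa i = xb i ∧ ya i = yb i ∧ za i = zb i)) :
    CoveredByPieces (transversalCoords J xa xb ya yb za zb) 1 := by
  have hconv : Convex ℝ (transversalCoords J xa xb ya yb za zb) := by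
    rintro ⟨t, u⟩ hp ⟨t', u'⟩ hp' w w' hw hw' hww i
    simp only [Prod.smul_mk, Prod.mk_add_mk, smul_eq_mul]
    have hlin : ∀ a z v v' : ℝ, a - z * (w * v + w' * v') = w * (a - z * v) + w' * (a - z * v') :=
      fun a z v v' => by linear_combination (-a) * hww
    simp only [hlin]
    obtain ⟨s, hs, e1, e2⟩ := hp i
    obtain ⟨s', hs', e1', e2'⟩ := hp' i
    dsimp only at e1 e2 e1' e2'
    rcases h i with ⟨h1, h2, h3, h4⟩ | ⟨h1, h2, h3, h4⟩ | ⟨h1, h2, h3⟩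
    · obtain ⟨r, hr, e⟩ := exists_affine_zero_combination (hJ i) (by
        rw [h3, h4]; nlinarith [sq_nonneg (ya i - yb i)]) ⟨s, hs, e2⟩ ⟨s', hs', e2'⟩ hw hw'
      exact ⟨r, hr, by rw [h1, h2, h3, h4]; ring, e⟩
    · obtain ⟨r, hr, e⟩ := exists_affine_zero_combination (hJ i) (by
        rw [h3, h4]; nlinarith [sq_nonneg (xa i - xb i)]) ⟨s, hs, e1⟩ ⟨s', hs', e1'⟩ hw hw'
      exact ⟨r, hr, e, by rw [h1, h2, h3, h4]; ring⟩
    · refine ⟨s, hs, ?_, ?_⟩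
      · rw [h1, h3] at e1 e1' ⊢
        linear_combination w * e1 + w' * e1'
      · rw [h2, h3] at e2 e2' ⊢
        linear_combination w * e2 + w' * e2'
  refine CoveredByPieces.of_joinedIn fun x hx y hy => ?_
  exact (hconv.isPathConnected ⟨x, hx⟩).joinedIn x hx y hy

theorem quadratic_roots_ncard_le {a b c : ℝ} (h : ¬ (a = 0 ∧ b = 0 ∧ c = 0)) :
    {t : ℝ | a * t ^ 2 + b * t + c = 0}.Finite ∧ {t : ℝ | a * t ^ 2 + b * t + c = 0}.ncard ≤ 2 := by
  open Polynomial in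
  let q : ℝ[X] := C a * X ^ 2 + C b * X + C c
  have hq : q ≠ 0 := by
    intro h0
    apply h
    refine ⟨?_, ?_, ?_⟩
    · have := congrArg (fun p : Polynomial ℝ => p.coeff 2) h0
      simpa [q, Polynomial.coeff_X, Polynomial.coeff_C] using this
    · have := congrArg (fun p : Polynomial ℝ => p.coeff 1) h0
      simpa [q, Polynomial.coeff_X, Polynomial.coeff_C] using this
    · have := congrArg (fun p : Polynomial ℝ => p.coeff 0) h0
      simpa [q, Polynomial.coeff_X, Polynomial.coeff_C] using this
  have hsub : {t : ℝ | a * t ^ 2 + b * t + c = 0} = (q.roots.toFinset : Set ℝ) := by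
    ext t
    simp [q, hq, Polynomial.IsRoot]
  rw [hsub, Set.ncard_coe_finset]
  refine ⟨Finset.finite_toSet _, (Multiset.toFinset_card_le _).trans
    ((Polynomial.card_roots' _).trans Polynomial.natDegree_quadratic_le)⟩

/-- The curve is the graph of the Möbius function `m`, so `t` alone parametrizes the transversals.
Cuts are placed at its pole and, for each segment of varying height, where the parameter of the
meeting point becomes infinite. Between cuts, clearing the denominator `p t` of constant sign makes
the conditions affine in `t`. -/
theorem coveredByPieces_hyperbola [Fintype ι] (hJ : ∀ i, Convex ℝ (J i))
    (h₁ : za i₁ = 0 ∧ zb i₁ = 0) (h₂ : za i₂ = 1 ∧ zb i₂ = 1)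
    {α β γ δ : ℝ} (hdet : α * δ - β * γ ≠ 0)
    (hS : ∀ p ∈ transversalCoords J xa xb ya yb za zb,
      α * (p.1 * p.2) + β * p.1 + γ * p.2 + δ = 0)
    (h : ∀ i, ((xa i = 0 ∧ xb i = 0 ∧ za i = 1 ∧ zb i = 1) ∨
      (ya i = 0 ∧ yb i = 0 ∧ za i = 0 ∧ zb i = 0) ∨ (xa i = xb i ∧ ya i = yb i ∧ za i = zb i)) ∨
      ∃ κ : ℝ, κ ≠ 0 ∧ zb i - za i = κ * α ∧ -(1 - za i) * yb i + (1 - zb i) * ya i = κ * β ∧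
        -xa i * zb i + xb i * za i = κ * γ ∧ xa i * yb i - xb i * ya i = κ * δ) :
    CoveredByPieces (transversalCoords J xa xb ya yb za zb) (Fintype.card ι) := by
  classical
  let p : ℝ → ℝ := fun t => γ + α * t
  let m : ℝ → ℝ := fun t => -(δ + β * t) / p t
  let K : Set ℝ := {t | p t ≠ 0 ∧ (t, m t) ∈ transversalCoords J xa xb ya yb za zb}
  have hm : ∀ t, p t ≠ 0 → m t * p t = -(δ + β * t) := fun t ht => div_mul_cancel₀ _ ht
  have hSK : transversalCoords J xa xb ya yb za zb = (fun t => (t, m t)) '' K := by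
    ext ⟨t, u⟩
    simp only [Set.mem_image, Prod.mk.injEq]
    constructor
    · intro ht
      have e := hS _ ht
      dsimp only at e
      have hp : p t ≠ 0 := by
        intro h0
        have h0' : γ + α * t = 0 := h0
        apply hdet
        have e' : δ + β * t = 0 := by linear_combination e - u * h0'
        linear_combination α * e' - β * h0'
      have hu : m t = u := by
        have : (m t - u) * p t = 0 := by
          rw [sub_mul, hm t hp]
          simp only [p]
          linear_combination -e
        linarith [(mul_eq_zero.1 this).resolve_right hp]
      exact ⟨t, ⟨hp, by rw [hu]; exact ht⟩, rfl, hu⟩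
    · rintro ⟨t', ⟨-, ht⟩, rfl, rfl⟩
      exact ht
  have hcont : ContinuousOn (fun t => (t, m t)) K := by
    refine continuousOn_id.prodMk (ContinuousOn.div (by fun_prop) (by fun_prop) fun t ht => ht.1)
  let I : Finset ι := Finset.univ.filter fun i => za i ≠ zb i
  -- For `α = 0` there is no pole, and the inserted value `0` is a harmless extra cut.
  let F : Finset ℝ := insert (-γ / α) (I.image fun i => -(xa i - xb i) / (za i - zb i))
  have hF : F.card + 1 ≤ Fintype.card ι := by
    have h2 := card_filter_add_two_le h₁ h₂ I (by simp [I])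
    have h3 : (I.image fun i => -(xa i - xb i) / (za i - zb i)).card ≤ I.card :=
      Finset.card_image_le
    have h4 : F.card ≤ _ := Finset.card_insert_le (-γ / α) _
    omega
  have hK : CoveredByPieces K (F.card + 1) := by
    refine CoveredByPieces.of_cuts F fun x hx y hy hxy hcut w w' hw hw' hww => ?_
    have hpp : 0 < p x * p y := by
      refine lt_of_le_of_ne (affine_mul_nonneg (fun _ => ?_) hxy) ?_
      · exact hcut _ (Finset.mem_insert_self _ _)
      · exact (mul_ne_zero hx.1 hy.1).symm
    have hpz : p (w * x + w' * y) = w * p x + w' * p y := by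
      simp only [p]
      linear_combination (-γ) * hww
    have hpz0 : p (w * x + w' * y) ≠ 0 := by
      rw [hpz]
      intro h0
      have e1 : w * p x * p x + w' * (p x * p y) = 0 := by linear_combination p x * h0
      have e2 : w * (p x * p y) + w' * (p y * p y) = 0 := by linear_combination p y * h0
      have n1 : 0 ≤ w * p x * p x := by
        rw [mul_assoc]; exact mul_nonneg hw (mul_self_nonneg _)
      have n2 : 0 ≤ w' * (p y * p y) := mul_nonneg hw' (mul_self_nonneg _)
      have n3 : w' * (p x * p y) ≤ 0 := by linarith
      have n4 : w * (p x * p y) ≤ 0 := by linarith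
      have : (w + w') * (p x * p y) ≤ 0 := by linarith
      rw [hww, one_mul] at this
      linarith
    have hlin : ∀ a z : ℝ, a - z * (w * x + w' * y) = w * (a - z * x) + w' * (a - z * y) :=
      fun a z => by linear_combination (-a) * hww
    -- the second family of conditions becomes affine in `t` after clearing denominators
    have hclear : ∀ t, p t ≠ 0 → ∀ s a b z z' : ℝ,
        (1 - s) * (a - z * m t) + s * (b - z' * m t) = 0 ↔
        (1 - s) * (a * p t + z * (δ + β * t)) + s * (b * p t + z' * (δ + β * t)) = 0 := by
      intro t ht s a b z z'
      have : (1 - s) * (a * p t + z * (δ + β * t)) + s * (b * p t + z' * (δ + β * t)) =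
          ((1 - s) * (a - z * m t) + s * (b - z' * m t)) * p t := by
        linear_combination ((1 - s) * z + s * z') * (hm t ht)
      rw [this, mul_eq_zero]
      simp [ht]
    have hlin2 : ∀ a z : ℝ, a * p (w * x + w' * y) + z * (δ + β * (w * x + w' * y)) =
        w * (a * p x + z * (δ + β * x)) + w' * (a * p y + z * (δ + β * y)) := by
      intro a z
      rw [hpz]
      linear_combination (-z * δ) * hww
    refine ⟨hpz0, fun i => ?_⟩
    obtain ⟨s, hs, e1, e2⟩ := hx.2 i
    obtain ⟨s', hs', e1', e2'⟩ := hy.2 i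
    dsimp only at e1 e2 e1' e2' ⊢
    rcases h i with (⟨h1, h2, h3, h4⟩ | ⟨h1, h2, h3, h4⟩ | ⟨h1, h2, h3⟩) | ⟨κ, hκ, k1, k2, k3, k4⟩
    · rw [hclear x hx.1] at e2
      rw [hclear y hy.1] at e2'
      obtain ⟨r, hr, e⟩ := exists_affine_zero_combination (hJ i) (by
        rw [h3, h4]
        have := mul_nonneg (mul_self_nonneg (ya i - yb i)) hpp.le
        linarith) ⟨s, hs, e2⟩ ⟨s', hs', e2'⟩ hw hw'
      refine ⟨r, hr, by rw [h1, h2, h3, h4]; ring, ?_⟩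
      rw [hclear _ hpz0, hlin2, hlin2]
      exact e
    · obtain ⟨r, hr, e⟩ := exists_affine_zero_combination (hJ i) (by
        rw [h3, h4]; nlinarith [sq_nonneg (xa i - xb i)]) ⟨s, hs, e1⟩ ⟨s', hs', e1'⟩ hw hw'
      refine ⟨r, hr, ?_, by rw [h1, h2, h3, h4]; ring⟩
      rw [hlin, hlin]
      exact e
    · refine ⟨s, hs, ?_, ?_⟩
      · rw [h1, h3] at e1 e1' ⊢
        rw [hlin]
        linear_combination w * e1 + w' * e1'
      · rw [hclear x hx.1] at e2
        rw [hclear y hy.1] at e2'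
        rw [hclear _ hpz0, hlin2, hlin2]
        rw [h2, h3] at e2 e2' ⊢
        linear_combination w * e2 + w' * e2'
    · obtain ⟨r, hr, e⟩ := exists_affine_zero_combination (hJ i) (by
        have := affine_mul_nonneg (a := xa i - xb i) (b := za i - zb i) (x := x) (y := y)
          (fun hz => hcut _ (Finset.mem_insert_of_mem (Finset.mem_image_of_mem _ (by
            simp only [I, Finset.mem_filter, Finset.mem_univ, true_and]
            exact sub_ne_zero.1 hz)))) hxy
        convert this using 2 <;> ring) ⟨s, hs, e1⟩ ⟨s', hs', e1'⟩ hw hw'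
      rw [← hlin, ← hlin] at e
      set t := w * x + w' * y
      refine ⟨r, hr, e, ?_⟩
      -- On the curve the determinant vanishes, so the second equation follows from the first unless
      -- both coefficients of the first are zero. That would place the segment in the plane of `t`
      -- and force `κ * p t = 0`.
      have hrel : (xa i - (1 - za i) * t) * (yb i - zb i * m t) =
          (xb i - (1 - zb i) * t) * (ya i - za i * m t) := by
        have hmt := hm t hpz0
        simp only [p] at hmt
        linear_combination (t * m t) * k1 + t * k2 + m t * k3 + k4 + κ * hmt
      have hnot : ¬ (xa i - (1 - za i) * t = 0 ∧ xb i - (1 - zb i) * t = 0) := by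
        rintro ⟨ha, hb⟩
        have : κ * p t = 0 := by
          simp only [p]
          linear_combination (-t) * k1 - k3 - zb i * ha + za i * hb
        exact (mul_ne_zero hκ hpz0) this
      by_contra hne
      apply hnot
      constructor
      · refine (mul_eq_zero.1 (?_ : _ * ((1 - r) * (ya i - za i * m t) +
          r * (yb i - zb i * m t)) = 0)).resolve_right hne
        linear_combination r * hrel + (ya i - za i * m t) * e
      · refine (mul_eq_zero.1 (?_ : _ * ((1 - r) * (ya i - za i * m t) +
          r * (yb i - zb i * m t)) = 0)).resolve_right hne
        linear_combination (-(1 - r)) * hrel + (yb i - zb i * m t) * e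
  rw [hSK]
  exact (hK.mono hF).image hcont (g := Prod.fst) (by fun_prop) fun _ _ => rfl

/-- For `α ≠ 0` the form times `α` is `(α t + γ) (α u + β)`. For `α = 0` it depends on one variable
only, and the other coordinate of the cross is an arbitrary `0`. -/
theorem bilinear_factor {α β γ δ : ℝ} (hdet : α * δ - β * γ = 0)
    (h0 : ¬ (α = 0 ∧ β = 0 ∧ γ = 0 ∧ δ = 0)) :
    ∃ t₀ u₀ : ℝ, ∀ t u : ℝ, α * (t * u) + β * t + γ * u + δ = 0 → t = t₀ ∨ u = u₀ := by
  by_cases hα : α = 0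
  · subst hα
    have : β * γ = 0 := by linarith
    rcases mul_eq_zero.1 this with rfl | rfl
    · refine ⟨0, -δ / γ, fun t u h => Or.inr ?_⟩
      have hγ : γ ≠ 0 := by
        rintro rfl
        exact h0 ⟨rfl, rfl, rfl, by linarith⟩
      field_simp
      linarith
    · refine ⟨-δ / β, 0, fun t u h => Or.inl ?_⟩
      have hβ : β ≠ 0 := by
        rintro rfl
        exact h0 ⟨rfl, rfl, rfl, by linarith⟩
      field_simp
      linarith
  · refine ⟨-γ / α, -β / α, fun t u h => ?_⟩
    have : (α * t + γ) * (α * u + β) = 0 := by linear_combination α * h - hdet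
    rcases mul_eq_zero.1 this with h | h
    · left; field_simp; linarith
    · right; field_simp; linarith

/-- The three hypotheses are the vanishing coefficients of the quadratic in `t` obtained by
eliminating `u` from two relations. -/
theorem exists_proportional {α β γ δ α' β' γ' δ' : ℝ} (hdet : α * δ - β * γ ≠ 0)
    (q1 : β' * α - α' * β = 0) (q2 : β' * γ - α' * δ - γ' * β + δ' * α = 0)
    (q3 : δ' * γ - γ' * δ = 0) :
    ∃ κ : ℝ, α' = κ * α ∧ β' = κ * β ∧ γ' = κ * γ ∧ δ' = κ * δ := by
  refine ⟨(α' * δ - β' * γ) / (α * δ - β * γ), ?_, ?_, ?_, ?_⟩ <;>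
    rw [div_mul_eq_mul_div, eq_div_iff hdet]
  · linear_combination γ * q1
  · linear_combination δ * q1
  · linear_combination γ * q2 - α * q3
  · linear_combination δ * q2 - β * q3

/-- The coordinates of the transversals to `n` segments, two of which lie on the skew axes, form
at most `n` pieces. -/
theorem coveredByPieces_transversalCoords [Fintype ι] (hJ : ∀ i, Convex ℝ (J i))
    (h₁ : za i₁ = 0 ∧ zb i₁ = 0) (h₂ : za i₂ = 1 ∧ zb i₂ = 1) :
    CoveredByPieces (transversalCoords J xa xb ya yb za zb) (Fintype.card ι) := by
  -- With no cuts this says `2 ≤ n`, which is needed for the convex case and for the case of at most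
  -- two lines.
  have hcard := card_filter_add_two_le h₁ h₂ ∅ (by simp)
  by_cases htriv : ∀ i, zb i - za i = 0 ∧ -(1 - za i) * yb i + (1 - zb i) * ya i = 0 ∧
      -xa i * zb i + xb i * za i = 0 ∧ xa i * yb i - xb i * ya i = 0
  · exact (coveredByPieces_of_trivial_relations hJ fun i => trivial_relation_cases (htriv i).1
      (htriv i).2.1 (htriv i).2.2.1 (htriv i).2.2.2).mono (by omega)
  obtain ⟨j, hj⟩ := not_forall.1 htriv
  by_cases hdet : (zb j - za j) * (xa j * yb j - xb j * ya j) -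
      (-(1 - za j) * yb j + (1 - zb j) * ya j) * (-xa j * zb j + xb j * za j) = 0
  · obtain ⟨t₀, u₀, h⟩ := bilinear_factor hdet hj
    exact coveredByPieces_cross hJ h₁ h₂ t₀ u₀ fun p hp => h _ _ (bilinear_relation (hp j))
  set α := zb j - za j
  set β := -(1 - za j) * yb j + (1 - zb j) * ya j
  set γ := -xa j * zb j + xb j * za j
  set δ := xa j * yb j - xb j * ya j
  by_cases hprop : ∀ i, ∃ κ : ℝ, zb i - za i = κ * α ∧
      -(1 - za i) * yb i + (1 - zb i) * ya i = κ * β ∧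
        -xa i * zb i + xb i * za i = κ * γ ∧ xa i * yb i - xb i * ya i = κ * δ
  · refine coveredByPieces_hyperbola hJ h₁ h₂ hdet (fun p hp => bilinear_relation (hp j))
      fun i => ?_
    obtain ⟨κ, k1, k2, k3, k4⟩ := hprop i
    by_cases hκ : κ = 0
    · subst hκ
      rw [zero_mul] at k1 k2 k3 k4
      exact Or.inl (trivial_relation_cases k1 k2 k3 k4)
    · exact Or.inr ⟨κ, hκ, k1, k2, k3, k4⟩
  · obtain ⟨i, hi⟩ := not_forall.1 hprop
    set α' := zb i - za i
    set β' := -(1 - za i) * yb i + (1 - zb i) * ya i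
    set γ' := -xa i * zb i + xb i * za i
    set δ' := xa i * yb i - xb i * ya i
    have hS : ∀ q ∈ transversalCoords J xa xb ya yb za zb,
        α * (q.1 * q.2) + β * q.1 + γ * q.2 + δ = 0 := fun q hq => bilinear_relation (hq j)
    have hS' : ∀ q ∈ transversalCoords J xa xb ya yb za zb,
        α' * (q.1 * q.2) + β' * q.1 + γ' * q.2 + δ' = 0 := fun q hq => bilinear_relation (hq i)
    have hne : ¬ (β' * α - α' * β = 0 ∧ (β' * γ - α' * δ - γ' * β + δ' * α) = 0 ∧
        δ' * γ - γ' * δ = 0) := fun h => hi (exists_proportional hdet h.1 h.2.1 h.2.2)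
    -- Two independent relations make `t` a root of a nonzero quadratic, and `t` determines `u` on
    -- the nondegenerate curve.
    obtain ⟨hfin, hcard2⟩ := quadratic_roots_ncard_le hne
    have hmaps : ∀ q ∈ transversalCoords J xa xb ya yb za zb, q.1 ∈
        {t : ℝ | (β' * α - α' * β) * t ^ 2 + (β' * γ - α' * δ - γ' * β + δ' * α) * t +
          (δ' * γ - γ' * δ) = 0} := by
      intro q hq
      have e := hS q hq
      have e' := hS' q hq
      show _ = (0 : ℝ)
      linear_combination (α * q.1 + γ) * e' - (α' * q.1 + γ') * e
    have hinj : Set.InjOn Prod.fst (transversalCoords J xa xb ya yb za zb) := by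
      rintro ⟨t, u⟩ hq ⟨t', u'⟩ hq' htt
      obtain rfl : t = t' := htt
      have e := hS _ hq
      have e' := hS _ hq'
      dsimp only at e e'
      have hp : α * t + γ ≠ 0 := by
        intro h0
        apply hdet
        have : δ + β * t = 0 := by linear_combination e - u * h0
        linear_combination α * this - β * h0
      have : (u - u') * (α * t + γ) = 0 := by linear_combination e - e'
      rw [Prod.mk.injEq]
      exact ⟨rfl, by linarith [(mul_eq_zero.1 this).resolve_right hp]⟩
    have hfinS := Set.Finite.of_finite_image (hfin.subset (Set.image_subset_iff.2 hmaps)) hinj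
    exact CoveredByPieces.of_finite hfinS
      ((Set.ncard_le_ncard_of_injOn _ hmaps hinj hfin).trans (by omega))

end

/-! ### The topology of line space -/

namespace Line

/-- The line through `p` with direction `v`. -/
noncomputable def ofPointDir (p v : Space) (hv : v ≠ 0) : Line := Line.through (p, ⟨v, hv⟩)

theorem mem_ofPointDir {p v x : Space} {hv : v ≠ 0} :
    x ∈ (ofPointDir p v hv).points ↔ ∃ r : ℝ, x = p + r • v := by
  change x ∈ AffineSubspace.mk' p (Submodule.span ℝ {v}) ↔ _
  rw [AffineSubspace.mem_mk', Submodule.mem_span_singleton]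
  simp only [vsub_eq_sub]
  exact exists_congr fun r => by rw [eq_comm, sub_eq_iff_eq_add']

theorem ext_points {ℓ ℓ' : Line} (h : ℓ.points = ℓ'.points) : ℓ = ℓ' :=
  Subtype.ext (SetLike.coe_injective h)

theorem exists_eq_ofPointDir (ℓ : Line) : ∃ (p v : Space) (hv : v ≠ 0), ℓ = ofPointDir p v hv := by
  obtain ⟨L, hL⟩ := ℓ
  obtain ⟨v, hv, hspan⟩ := finrank_eq_one_iff'.1 hL
  have hne : L ≠ ⊥ := by
    rintro rfl
    rw [AffineSubspace.direction_bot, finrank_bot] at hL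
    exact zero_ne_one hL
  obtain ⟨p, hp⟩ := (AffineSubspace.nonempty_iff_ne_bot L).2 hne
  refine ⟨p, v, by simpa using hv, ext_points ?_⟩
  ext x
  rw [mem_ofPointDir]
  constructor
  · intro hx
    obtain ⟨r, hr⟩ := hspan ⟨x -ᵥ p, AffineSubspace.vsub_mem_direction hx hp⟩
    refine ⟨r, ?_⟩
    have := congrArg Subtype.val hr
    simp only [vsub_eq_sub] at this
    have h2 : r • (v : Space) = x - p := this
    rw [h2]; abel
  · rintro ⟨r, rfl⟩
    have := AffineSubspace.vadd_mem_of_mem_direction (L.direction.smul_mem r v.2) hp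
    rw [vadd_eq_add, add_comm] at this
    exact this

theorem ofPointDir_eq_of_mem {p v q w : Space} {hv : v ≠ 0} (hq : q ∈ (ofPointDir p v hv).points)
    {c : ℝ} (hw : w = c • v) (hw0 : w ≠ 0) : ofPointDir p v hv = ofPointDir q w hw0 := by
  obtain ⟨r, rfl⟩ := mem_ofPointDir.1 hq
  have hc : c ≠ 0 := by
    rintro rfl
    exact hw0 (by rw [hw, zero_smul])
  subst hw
  apply ext_points
  ext x
  rw [mem_ofPointDir, mem_ofPointDir]
  constructor
  · rintro ⟨s, rfl⟩
    refine ⟨(s - r) / c, ?_⟩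
    rw [smul_smul, div_mul_cancel₀ _ hc]
    module
  · rintro ⟨s, rfl⟩
    refine ⟨r + s * c, by module⟩

theorem eq_ofPointDir_sub {ℓ : Line} {x y : Space} (hx : x ∈ ℓ.points) (hy : y ∈ ℓ.points)
    (hxy : y - x ≠ 0) : ℓ = ofPointDir x (y - x) hxy := by
  obtain ⟨p, v, hv, rfl⟩ := ℓ.exists_eq_ofPointDir
  obtain ⟨r, hr⟩ := mem_ofPointDir.1 hx
  obtain ⟨s, hs⟩ := mem_ofPointDir.1 hy
  refine ofPointDir_eq_of_mem hx (c := s - r) ?_ hxy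
  rw [hr, hs]; module

theorem eq_of_mem {ℓ ℓ' : Line} {x y : Space} (hxy : x ≠ y) (hx : x ∈ ℓ.points)
    (hy : y ∈ ℓ.points) (hx' : x ∈ ℓ'.points) (hy' : y ∈ ℓ'.points) : ℓ = ℓ' := by
  rw [eq_ofPointDir_sub hx hy (sub_ne_zero.2 hxy.symm),
    eq_ofPointDir_sub hx' hy' (sub_ne_zero.2 hxy.symm)]

theorem isQuotientMap_through : Topology.IsQuotientMap Line.through := by
  refine ⟨?_, ?_⟩
  swap
  · intro ℓ
    obtain ⟨p, v, hv, rfl⟩ := ℓ.exists_eq_ofPointDir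
    exact ⟨(p, ⟨v, hv⟩), rfl⟩
  · exact ⟨rfl⟩

theorem isClosed_iff {C : Set Line} :
    IsClosed C ↔ IsClosed {x : Space × {v : Space // v ≠ 0} | ofPointDir x.1 x.2.1 x.2.2 ∈ C} :=
  (isQuotientMap_through.isClosed_preimage (s := C)).symm

/-- The pairs representing a fixed line are given by two closed conditions: the direction and the
difference of base points lie in its span. -/
instance : T1Space Line := by
  refine ⟨fun ℓ => isClosed_iff.2 ?_⟩
  obtain ⟨q, w, hw, rfl⟩ := ℓ.exists_eq_ofPointDir
  have hset : {x : Space × {v : Space // v ≠ 0} |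
      ofPointDir x.1 x.2.1 x.2.2 ∈ ({ofPointDir q w hw} : Set Line)} =
      (fun x => x.1 - q) ⁻¹' (Submodule.span ℝ {w} : Set Space) ∩
        (fun x => x.2.1) ⁻¹' (Submodule.span ℝ {w} : Set Space) := by
    ext ⟨p, v, hv⟩
    simp only [Set.mem_singleton_iff, Set.mem_inter_iff, Set.mem_preimage, SetLike.mem_coe,
      Submodule.mem_span_singleton, Set.mem_ofPred_eq]
    constructor
    · intro h
      have h1 : p ∈ (ofPointDir q w hw).points := by
        rw [← h]; exact mem_ofPointDir.2 ⟨0, by simp⟩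
      have h2 : p + v ∈ (ofPointDir q w hw).points := by
        rw [← h]; exact mem_ofPointDir.2 ⟨1, by simp⟩
      obtain ⟨r, hr⟩ := mem_ofPointDir.1 h1
      obtain ⟨s, hs⟩ := mem_ofPointDir.1 h2
      refine ⟨⟨r, by rw [hr]; module⟩, s - r, ?_⟩
      have : v = (p + v) - p := by abel
      rw [this, hs, hr]; module
    · rintro ⟨⟨r, hr⟩, s, hs⟩
      exact (ofPointDir_eq_of_mem (mem_ofPointDir.2 ⟨r, by rw [hr]; abel⟩) hs.symm hv).symm
  rw [hset]
  have hcl : IsClosed (Submodule.span ℝ {w} : Set Space) :=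
    Submodule.closed_of_finiteDimensional _
  exact (hcl.preimage (by fun_prop)).inter (hcl.preimage (by fun_prop))

theorem continuous_ofPointDir {Z : Type*} [TopologicalSpace Z] {p v : Z → Space}
    (hp : Continuous p) (hv : Continuous v) (h0 : ∀ z, v z ≠ 0) :
    Continuous fun z => ofPointDir (p z) (v z) (h0 z) :=
  isQuotientMap_through.continuous.comp (hp.prodMk (hv.subtype_mk h0))

theorem joinedIn_of_path {T : Set Line} {ℓ ℓ' : Line} {p v : ℝ → Space} (hp : Continuous p)
    (hv : Continuous v) (h0 : ∀ τ ∈ Set.Icc (0 : ℝ) 1, v τ ≠ 0)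
    (hT : ∀ τ, (hτ : τ ∈ Set.Icc (0 : ℝ) 1) → ofPointDir (p τ) (v τ) (h0 τ hτ) ∈ T)
    (hℓ : ofPointDir (p 0) (v 0) (h0 0 (by simp)) = ℓ)
    (hℓ' : ofPointDir (p 1) (v 1) (h0 1 (by simp)) = ℓ') : JoinedIn T ℓ ℓ' := by
  have hc : Continuous fun τ : unitInterval => ofPointDir (p τ) (v τ) (h0 τ τ.2) :=
    continuous_ofPointDir (hp.comp continuous_subtype_val) (hv.comp continuous_subtype_val) _
  exact ⟨⟨⟨_, hc⟩, hℓ, hℓ'⟩, fun τ => hT τ τ.2⟩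

/-- The image of a line under an affine equivalence. -/
noncomputable def map (φ : Space ≃ᵃ[ℝ] Space) (ℓ : Line) : Line :=
  ⟨ℓ.1.map (φ : Space →ᵃ[ℝ] Space), by
    rw [AffineSubspace.map_direction]
    exact (LinearEquiv.finrank_map_eq φ.linear _).trans ℓ.2⟩

theorem points_map (φ : Space ≃ᵃ[ℝ] Space) (ℓ : Line) : (ℓ.map φ).points = φ '' ℓ.points :=
  AffineSubspace.coe_map _ _

theorem continuous_map (φ : Space ≃ᵃ[ℝ] Space) : Continuous (map φ) := by
  rw [isQuotientMap_through.continuous_iff]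
  have hne : ∀ x : Space × {v : Space // v ≠ 0}, φ.linear x.2.1 ≠ 0 := fun x => by
    simpa using x.2.2
  have : map φ ∘ through = fun x => ofPointDir (φ x.1) (φ.linear x.2.1) (hne x) := by
    funext x
    apply ext_points
    change ((ofPointDir x.1 x.2.1 x.2.2).map φ).points = _
    rw [points_map]
    ext y
    simp only [Set.mem_image, mem_ofPointDir]
    constructor
    · rintro ⟨_, ⟨r, rfl⟩, rfl⟩
      refine ⟨r, ?_⟩
      have := φ.map_vadd x.1 (r • x.2.1)
      rw [vadd_eq_add, vadd_eq_add, map_smul] at this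
      rw [add_comm, this, add_comm]
    · rintro ⟨r, rfl⟩
      refine ⟨_, ⟨r, rfl⟩, ?_⟩
      have := φ.map_vadd x.1 (r • x.2.1)
      rw [vadd_eq_add, vadd_eq_add, map_smul] at this
      rw [add_comm, this, add_comm]
  rw [this]
  have h1 : Continuous φ := φ.toAffineMap.continuous_of_finiteDimensional
  have h2 : Continuous φ.linear := φ.linear.toLinearMap.continuous_of_finiteDimensional
  exact continuous_ofPointDir (h1.comp continuous_fst)
    (h2.comp (continuous_subtype_val.comp continuous_snd)) _

theorem map_symm_map (φ : Space ≃ᵃ[ℝ] Space) (ℓ : Line) : (ℓ.map φ).map φ.symm = ℓ := by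
  apply ext_points
  rw [points_map, points_map, Set.image_image]
  simp

/-- The `i`-th coordinate of the point of a line at height `c`. -/
noncomputable def coordAt (c : ℝ) (i : Fin 3) (ℓ : Line) : ℝ :=
  open Classical in if h : ∃ x ∈ ℓ.points, x 2 = c then h.choose i else 0

/-- The lines that are not horizontal. -/
def slanted : Set Line := {ℓ | ∃ x ∈ ℓ.points, ∃ y ∈ ℓ.points, x 2 ≠ y 2}

theorem ofPointDir_mem_slanted {p v : Space} {hv : v ≠ 0} :
    ofPointDir p v hv ∈ slanted ↔ v 2 ≠ 0 := by
  constructor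
  · rintro ⟨x, hx, y, hy, hxy⟩ h0
    obtain ⟨r, rfl⟩ := mem_ofPointDir.1 hx
    obtain ⟨s, rfl⟩ := mem_ofPointDir.1 hy
    simp [h0] at hxy
  · intro h0
    refine ⟨p, mem_ofPointDir.2 ⟨0, by simp⟩, p + v, mem_ofPointDir.2 ⟨1, by simp⟩, ?_⟩
    simpa using h0

theorem coordAt_eq {ℓ : Line} (hℓ : ℓ ∈ slanted) {x : Space} (hx : x ∈ ℓ.points) (i : Fin 3) :
    coordAt (x 2) i ℓ = x i := by
  have h : ∃ y ∈ ℓ.points, y 2 = x 2 := ⟨x, hx, rfl⟩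
  rw [coordAt, dif_pos h]
  obtain ⟨hy, hy2⟩ := h.choose_spec
  set y := h.choose
  obtain ⟨p, v, hv, rfl⟩ := ℓ.exists_eq_ofPointDir
  rw [ofPointDir_mem_slanted] at hℓ
  obtain ⟨r, hr⟩ := mem_ofPointDir.1 hx
  obtain ⟨s, hs⟩ := mem_ofPointDir.1 hy
  rw [hr, hs] at hy2
  have : s = r := by
    have h3 : (s - r) * v 2 = 0 := by
      simp at hy2
      rcases hy2 with h | h
      · rw [h]; ring
      · exact absurd h hℓ
    rcases mul_eq_zero.1 h3 with h | h
    · linarith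
    · exact absurd h hℓ
  rw [hr, hs, this]

/-- Slanted lines form an open set, so continuity may be checked on pairs of point and direction,
where the value is a quotient with denominator `v 2`. These coordinates are the continuous inverses
of the parametrizations of transversals. -/
theorem continuousOn_coordAt (c : ℝ) (i : Fin 3) : ContinuousOn (coordAt c i) slanted := by
  have hpre : through ⁻¹' slanted = {x : Space × {v : Space // v ≠ 0} | x.2.1 2 ≠ 0} := by
    ext x
    exact ofPointDir_mem_slanted (p := x.1) (v := x.2.1) (hv := x.2.2)
  have hopen : IsOpen slanted := by
    rw [← isQuotientMap_through.isOpen_preimage, hpre]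
    exact isOpen_ne_fun (by fun_prop) (by fun_prop)
  rw [isQuotientMap_through.continuousOn_isOpen_iff hopen, hpre]
  have hform : Set.EqOn (coordAt c i ∘ through)
      (fun x => x.1 i + (c - x.1 2) / x.2.1 2 * x.2.1 i)
      {x : Space × {v : Space // v ≠ 0} | x.2.1 2 ≠ 0} := by
    rintro ⟨p, v, hv⟩ (h0 : v 2 ≠ 0)
    have hmem : p + ((c - p 2) / v 2) • v ∈ (ofPointDir p v hv).points :=
      mem_ofPointDir.2 ⟨_, rfl⟩
    have := coordAt_eq (ofPointDir_mem_slanted.2 h0) hmem i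
    have h2 : (p + ((c - p 2) / v 2) • v) 2 = c := by
      simp; field_simp; ring
    rw [h2] at this
    change coordAt c i (ofPointDir p v hv) = _
    rw [this]
    simp
  refine ContinuousOn.congr ?_ hform
  have : ∀ j : Fin 3, Continuous fun x : Space × {v : Space // v ≠ 0} => x.2.1 j := fun j => by
    fun_prop
  refine ContinuousOn.add (by fun_prop) (ContinuousOn.mul (ContinuousOn.div (by fun_prop)
    (this 2).continuousOn fun x hx => hx) (this i).continuousOn)

end Line

theorem CoveredByPieces.of_affineEquiv {ι : Type} {s : ι → Set Space} {m : ℕ}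
    (φ : Space ≃ᵃ[ℝ] Space) (h : CoveredByPieces (transversals fun i => φ '' s i) m) :
    CoveredByPieces (transversals s) m := by
  have hmem : ∀ ℓ : Line, ∀ ψ : Space ≃ᵃ[ℝ] Space, ∀ r : ι → Set Space,
      ℓ ∈ transversals r → ℓ.map ψ ∈ transversals fun i => ψ '' r i := by
    intro ℓ ψ r hℓ i
    obtain ⟨x, hx, hxr⟩ := hℓ i
    rw [Line.points_map]
    exact ⟨ψ x, ⟨x, hx, rfl⟩, ⟨x, hxr, rfl⟩⟩
  have himg : Line.map φ.symm '' (transversals fun i => φ '' s i) = transversals s := by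
    ext ℓ
    constructor
    · rintro ⟨ℓ', hℓ', rfl⟩
      have := hmem ℓ' φ.symm _ hℓ'
      simpa [Set.image_image] using this
    · intro hℓ
      exact ⟨ℓ.map φ, hmem ℓ φ s hℓ, ℓ.map_symm_map φ⟩
  have h' := h.image (f := Line.map φ.symm) (g := Line.map φ)
    (Line.continuous_map _).continuousOn (Line.continuous_map _).continuousOn
    (fun ℓ _ => Line.map_symm_map φ.symm ℓ)
  rwa [himg] at h'

/-! ### Segments and affine frames -/

/-- The points `(1 - s) a + s b` with parameter `s` in `J`. -/
def segmentOf (a b : Space) (J : Set ℝ) : Set Space := (fun s : ℝ => (1 - s) • a + s • b) '' J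

/-- Closed, open and half-open segments differ only in `J`. The upper bound uses nothing about `J`
beyond convexity and nonemptiness. -/
theorem IsLineSegment.exists_eq_segmentOf {S : Set Space} (h : IsLineSegment S) :
    ∃ (a b : Space) (J : Set ℝ), Convex ℝ J ∧ J.Nonempty ∧ S = segmentOf a b J := by
  obtain ⟨a, b, rfl | rfl | rfl⟩ := h
  · exact ⟨a, b, Set.Icc 0 1, convex_Icc _ _, ⟨0, by simp⟩, segment_eq_image ℝ a b⟩
  · exact ⟨a, b, Set.Ioo 0 1, convex_Ioo _ _, ⟨1 / 2, by norm_num⟩, openSegment_eq_image ℝ a b⟩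
  · refine ⟨a, b, Set.Ico 0 1, convex_Ico _ _, ⟨0, by simp⟩, ?_⟩
    rw [openSegment_eq_image, segmentOf, ← Set.Ioo_insert_left zero_lt_one, Set.image_insert_eq]
    simp

theorem segmentOf_image (φ : Space ≃ᵃ[ℝ] Space) (a b : Space) (J : Set ℝ) :
    φ '' segmentOf a b J = segmentOf (φ a) (φ b) J := by
  rw [segmentOf, segmentOf, Set.image_image]
  refine Set.image_congr fun s _ => ?_
  have := (φ : Space →ᵃ[ℝ] Space).apply_lineMap a b s
  rw [AffineMap.lineMap_apply_module, AffineMap.lineMap_apply_module] at this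
  exact this

theorem linearIndependent_three {a b c : Space} :
    LinearIndependent ℝ ![a, b, c] ↔
      ∀ x y z : ℝ, x • a + y • b + z • c = 0 → x = 0 ∧ y = 0 ∧ z = 0 := by
  rw [Fintype.linearIndependent_iff]
  constructor
  · intro h x y z hxyz
    have := h ![x, y, z] (by simpa [Fin.sum_univ_three] using hxyz)
    exact ⟨this 0, this 1, this 2⟩
  · intro h g hg
    have := h (g 0) (g 1) (g 2) (by simpa [Fin.sum_univ_three] using hg)
    intro i
    fin_cases i
    · exact this.1
    · exact this.2.1
    · exact this.2.2

/-- An affine coordinate system with prescribed origin and axes. -/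
theorem exists_frame (o : Space) {a b c : Space} (h : LinearIndependent ℝ ![a, b, c]) :
    ∃ φ : Space ≃ᵃ[ℝ] Space, ∀ x y z : ℝ,
      φ (o + x • a + y • b + z • c) = !₂[x, y, z] := by
  let B := basisOfLinearIndependentOfCardEqFinrank h (by simp)
  let L : Space ≃ₗ[ℝ] Space := B.equivFun.trans (WithLp.linearEquiv 2 ℝ (Fin 3 → ℝ)).symm
  refine ⟨(AffineEquiv.constVAdd ℝ Space (-o)).trans L.toAffineEquiv, fun x y z => ?_⟩
  have h0 : B 0 = a := by simp [B]
  have h1 : B 1 = b := by simp [B]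
  have h2 : B 2 = c := by simp [B]
  have e : (-o +ᵥ (o + x • a + y • b + z • c)) = ∑ i, ![x, y, z] i • B i := by
    rw [Fin.sum_univ_three, h0, h1, h2, vadd_eq_add]
    simp
    abel
  have e2 : B.equivFun (∑ i, ![x, y, z] i • B i) = ![x, y, z] := by
    rw [← B.equivFun_symm_apply, LinearEquiv.apply_symm_apply]
  simp only [AffineEquiv.trans_apply, AffineEquiv.constVAdd_apply, LinearEquiv.coe_toAffineEquiv,
    L, LinearEquiv.trans_apply, e, e2]
  rfl

theorem exists_coords (φ : Space ≃ᵃ[ℝ] Space) (o : Space) {a b c : Space}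
    (h : ∀ x y z : ℝ, φ (o + x • a + y • b + z • c) = !₂[x, y, z]) (p : Space) :
    p = o + φ p 0 • a + φ p 1 • b + φ p 2 • c := by
  apply φ.injective
  rw [h]
  ext i
  fin_cases i <;> rfl

/-! ### Bridges between two skew axes -/

namespace Line

/-- The line through `(t, 0, 0)` and `(0, u, 1)`. -/
noncomputable def bridge (t u : ℝ) : Line :=
  ofPointDir !₂[t, 0, 0] !₂[-t, u, 1] (fun h => by
    have := congrArg (fun x : Space => x 2) h
    simp at this)

theorem mem_bridge {t u : ℝ} {x : Space} :
    x ∈ (bridge t u).points ↔ x 0 - (1 - x 2) * t = 0 ∧ x 1 - x 2 * u = 0 := by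
  rw [bridge, mem_ofPointDir]
  constructor
  · rintro ⟨r, rfl⟩
    constructor
    · simp; ring
    · simp
  · rintro ⟨h1, h2⟩
    refine ⟨x 2, ?_⟩
    ext i
    fin_cases i
    · simp; linarith
    · simp; linarith
    · simp

theorem continuous_bridge : Continuous fun p : ℝ × ℝ => bridge p.1 p.2 := by
  refine continuous_ofPointDir (p := fun p : ℝ × ℝ => !₂[p.1, 0, 0])
    (v := fun p : ℝ × ℝ => !₂[-p.1, p.2, 1]) ?_ ?_ _
  · refine (PiLp.continuous_toLp 2 _).comp (continuous_pi fun i => ?_)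
    fin_cases i
    · exact continuous_fst
    · exact continuous_const
    · exact continuous_const
  · refine (PiLp.continuous_toLp 2 _).comp (continuous_pi fun i => ?_)
    fin_cases i
    · exact continuous_fst.neg
    · exact continuous_snd
    · exact continuous_const

theorem bridge_mem_slanted (t u : ℝ) : bridge t u ∈ slanted := by
  rw [bridge, ofPointDir_mem_slanted]
  simp

theorem coordAt_zero_bridge (t u : ℝ) : coordAt 0 0 (bridge t u) = t := by
  have := coordAt_eq (bridge_mem_slanted t u) (x := !₂[t, 0, 0]) (mem_bridge.2 (by simp)) 0
  simpa using this

theorem coordAt_one_bridge (t u : ℝ) : coordAt 1 1 (bridge t u) = u := by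
  have := coordAt_eq (bridge_mem_slanted t u) (x := !₂[0, u, 1]) (mem_bridge.2 (by simp)) 1
  simpa using this

theorem eq_bridge {ℓ : Line} {x y : Space} (hx : x ∈ ℓ.points) (hy : y ∈ ℓ.points)
    (hx1 : x 1 = 0) (hx2 : x 2 = 0) (hy0 : y 0 = 0) (hy2 : y 2 = 1) :
    ℓ = bridge (x 0) (y 1) := by
  refine eq_of_mem (x := x) (y := y) ?_ hx hy (mem_bridge.2 ?_) (mem_bridge.2 ?_)
  · rintro rfl
    rw [hx2] at hy2
    exact zero_ne_one hy2
  · rw [hx1, hx2]; simp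
  · rw [hy0, hy2]; simp

/-- The set of bridges with coordinates in a set is homeomorphic to that set. -/
theorem coveredByPieces_bridge {S : Set (ℝ × ℝ)} {m : ℕ} (h : CoveredByPieces S m) :
    CoveredByPieces ((fun p : ℝ × ℝ => bridge p.1 p.2) '' S) m := by
  refine h.image (g := fun ℓ => (coordAt 0 0 ℓ, coordAt 1 1 ℓ)) continuous_bridge.continuousOn
    ?_ ?_
  · refine ContinuousOn.mono ((continuousOn_coordAt 0 0).prodMk (continuousOn_coordAt 1 1)) ?_
    rintro _ ⟨p, -, rfl⟩
    exact bridge_mem_slanted _ _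
  · rintro ⟨t, u⟩ -
    simp only [coordAt_zero_bridge, coordAt_one_bridge]

end Line

section

variable {ι : Type}

/-- Transversals to segments two of which lie on the axes `y = z = 0` and `x = 0, z = 1`. -/
theorem transversals_eq_image_bridge (a b : ι → Space) (J : ι → Set ℝ) {i₁ i₂ : ι}
    (h₁ : a i₁ 1 = 0 ∧ b i₁ 1 = 0 ∧ a i₁ 2 = 0 ∧ b i₁ 2 = 0)
    (h₂ : a i₂ 0 = 0 ∧ b i₂ 0 = 0 ∧ a i₂ 2 = 1 ∧ b i₂ 2 = 1) :
    transversals (fun i => segmentOf (a i) (b i) (J i)) =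
      (fun p : ℝ × ℝ => Line.bridge p.1 p.2) '' transversalCoords J (fun i => a i 0)
        (fun i => b i 0) (fun i => a i 1) (fun i => b i 1) (fun i => a i 2) (fun i => b i 2) := by
  have key : ∀ t u : ℝ, ∀ i, ((Line.bridge t u).points ∩ segmentOf (a i) (b i) (J i)).Nonempty ↔
      ∃ s ∈ J i, (1 - s) * (a i 0 - (1 - a i 2) * t) + s * (b i 0 - (1 - b i 2) * t) = 0 ∧
        (1 - s) * (a i 1 - a i 2 * u) + s * (b i 1 - b i 2 * u) = 0 := by
    intro t u i
    have : ∀ s : ℝ, (1 - s) • a i + s • b i ∈ (Line.bridge t u).points ↔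
        (1 - s) * (a i 0 - (1 - a i 2) * t) + s * (b i 0 - (1 - b i 2) * t) = 0 ∧
        (1 - s) * (a i 1 - a i 2 * u) + s * (b i 1 - b i 2 * u) = 0 := by
      intro s
      rw [Line.mem_bridge]
      simp only [PiLp.add_apply, PiLp.smul_apply, smul_eq_mul]
      constructor
      · rintro ⟨e1, e2⟩
        exact ⟨by linear_combination e1, by linear_combination e2⟩
      · rintro ⟨e1, e2⟩
        exact ⟨by linear_combination e1, by linear_combination e2⟩
    constructor
    · rintro ⟨_, hx, s, hs, rfl⟩
      exact ⟨s, hs, (this s).1 hx⟩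
    · rintro ⟨s, hs, h⟩
      exact ⟨_, (this s).2 h, s, hs, rfl⟩
  ext ℓ
  constructor
  · intro hℓ
    obtain ⟨_, hx, s, -, rfl⟩ := hℓ i₁
    obtain ⟨_, hy, s', -, rfl⟩ := hℓ i₂
    have := Line.eq_bridge hx hy (by simp [h₁]) (by simp [h₁]) (by simp [h₂]) (by simp [h₂])
    rw [this] at hℓ ⊢
    exact ⟨(_, _), fun i => (key _ _ i).1 (hℓ i), rfl⟩
  · rintro ⟨⟨t, u⟩, h, rfl⟩ i
    exact (key t u i).2 (h i)

/-- The linear independence says that the lines `x y` and `x' y'` are skew. The frame at `x` with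
these three vectors moves them to the axes `y = z = 0` and `x = 0, z = 1`. -/
theorem coveredByPieces_of_skew [Fintype ι] {a b : ι → Space} {J : ι → Set ℝ}
    (hJ : ∀ i, Convex ℝ (J i)) {i₁ i₂ : ι} {x y x' y' : Space}
    (hx : x ∈ segmentOf (a i₁) (b i₁) (J i₁)) (hy : y ∈ segmentOf (a i₁) (b i₁) (J i₁))
    (hx' : x' ∈ segmentOf (a i₂) (b i₂) (J i₂)) (hy' : y' ∈ segmentOf (a i₂) (b i₂) (J i₂))
    (hli : LinearIndependent ℝ ![y - x, y' - x', x' - x]) :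
    CoveredByPieces (transversals fun i => segmentOf (a i) (b i) (J i)) (Fintype.card ι) := by
  obtain ⟨φ, hφ⟩ := exists_frame x hli
  have hne1 : y - x ≠ 0 := by simpa using hli.ne_zero 0
  have hne2 : y' - x' ≠ 0 := by simpa using hli.ne_zero 1
  -- The endpoints need not belong to the segment, so they are recovered on the line through two of
  -- its points.
  have hcol : ∀ {a b x y : Space} {J : Set ℝ}, x ∈ segmentOf a b J → y ∈ segmentOf a b J →
      y - x ≠ 0 → ∃ c d : ℝ, a = x + c • (y - x) ∧ b = x + d • (y - x) := by
    rintro a b _ _ J ⟨s, -, rfl⟩ ⟨s', -, rfl⟩ hne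
    have hss : s' - s ≠ 0 := by
      intro h
      apply hne
      rw [sub_eq_zero.1 h, sub_self]
    have e : (1 - s') • a + s' • b - ((1 - s) • a + s • b) = (s' - s) • (b - a) := by module
    have e2 : b - a = (s' - s)⁻¹ • ((s' - s) • (b - a)) := by rw [smul_smul, inv_mul_cancel₀ hss, one_smul]
    refine ⟨-s * (s' - s)⁻¹, (1 - s) * (s' - s)⁻¹, ?_, ?_⟩
    · dsimp only
      rw [e, mul_smul, ← e2]
      module
    · dsimp only
      rw [e, mul_smul, ← e2]
      module
  obtain ⟨c, d, hc, hd⟩ := hcol hx hy hne1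
  obtain ⟨c', d', hc', hd'⟩ := hcol hx' hy' hne2
  have hφ1 : ∀ c : ℝ, φ (x + c • (y - x)) = !₂[c, 0, 0] := fun c => by
    rw [← hφ]; congr 1; module
  have hφ2 : ∀ c : ℝ, φ (x' + c • (y' - x')) = !₂[0, c, 1] := fun c => by
    rw [← hφ]; congr 1; module
  apply CoveredByPieces.of_affineEquiv φ
  simp only [segmentOf_image]
  have ha1 := hφ1 c
  have hb1 := hφ1 d
  have ha2 := hφ2 c'
  have hb2 := hφ2 d'
  rw [← hc] at ha1
  rw [← hd] at hb1
  rw [← hc'] at ha2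
  rw [← hd'] at hb2
  rw [transversals_eq_image_bridge (fun i => φ (a i)) (fun i => φ (b i)) J (i₁ := i₁) (i₂ := i₂)
    (by simp [ha1, hb1]) (by simp [ha2, hb2])]
  exact Line.coveredByPieces_bridge (coveredByPieces_transversalCoords hJ (i₁ := i₁) (i₂ := i₂)
    (by simp [ha1, hb1]) (by simp [ha2, hb2]))

/-! ### Segments with a common point -/

/-- If the members of a family of convex sets share a point, the transversals are connected. -/
theorem coveredByPieces_of_common_point {s : ι → Set Space} (hs : ∀ i, Convex ℝ (s i)) {c : Space}
    (hc : ∀ i, c ∈ s i) : CoveredByPieces (transversals s) 1 := by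
  have hthrough : ∀ v (hv : v ≠ 0), Line.ofPointDir c v hv ∈ transversals s := fun v hv i =>
    ⟨c, Line.mem_ofPointDir.2 ⟨0, by simp⟩, hc i⟩
  have h1 : ∀ ℓ ∈ transversals s, ∃ v, ∃ hv : v ≠ 0,
      JoinedIn (transversals s) ℓ (Line.ofPointDir c v hv) := by
    intro ℓ hℓ
    obtain ⟨p, v, hv, rfl⟩ := ℓ.exists_eq_ofPointDir
    refine ⟨v, hv, ?_⟩
    refine Line.joinedIn_of_path (p := fun τ => (1 - τ) • p + τ • c) (v := fun _ => v)
      (by fun_prop) (by fun_prop) (fun _ _ => hv) (fun τ hτ i => ?_) (by simp) (by simp)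
    obtain ⟨x, hx, hxs⟩ := hℓ i
    obtain ⟨r, rfl⟩ := Line.mem_ofPointDir.1 hx
    -- While the line is translated towards `c`, its meeting point moves straight to `c` and stays
    -- in the convex set.
    refine ⟨(1 - τ) • (p + r • v) + τ • c, Line.mem_ofPointDir.2 ⟨(1 - τ) * r, by module⟩, ?_⟩
    exact hs i hxs (hc i) (by linarith [hτ.2]) hτ.1 (by ring)
  have h2 : ∀ v (hv : v ≠ 0) w (hw : w ≠ 0),
      JoinedIn (transversals s) (Line.ofPointDir c v hv) (Line.ofPointDir c w hw) := by
    intro v hv w hw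
    have hpc : IsPathConnected ({0}ᶜ : Set Space) := isPathConnected_compl_singleton_of_one_lt_rank
      (by rw [← Module.finrank_eq_rank]; simp) 0
    obtain ⟨γ, hγ⟩ := hpc.joinedIn v hv w hw
    have hcont := Line.continuous_ofPointDir (p := fun _ => c) continuous_const γ.continuous hγ
    exact ⟨⟨⟨_, hcont⟩, by simp, by simp⟩, fun τ => hthrough _ _⟩
  refine CoveredByPieces.of_joinedIn fun ℓ hℓ ℓ' hℓ' => ?_
  obtain ⟨v, hv, hj⟩ := h1 ℓ hℓ
  obtain ⟨w, hw, hj'⟩ := h1 ℓ' hℓ'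
  exact (hj.trans (h2 v hv w hw)).trans hj'.symm

end

/-! ### Transversals inside a plane -/

namespace Line

/-- A scale-invariant property of differences of points is a property of the direction; this yields
closed sets of lines from closed sets of vectors. -/
theorem mem_directionSet {P : Space → Prop} (hP : ∀ (c : ℝ) v, P v → P (c • v)) {p v : Space}
    {hv : v ≠ 0} : ofPointDir p v hv ∈ {ℓ : Line | ∀ x ∈ ℓ.points, ∀ y ∈ ℓ.points, P (y - x)} ↔
      P v := by
  constructor
  · intro h
    have := h p (mem_ofPointDir.2 ⟨0, by simp⟩) (p + v) (mem_ofPointDir.2 ⟨1, by simp⟩)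
    simpa using this
  · intro h x hx y hy
    obtain ⟨r, rfl⟩ := mem_ofPointDir.1 hx
    obtain ⟨s, rfl⟩ := mem_ofPointDir.1 hy
    have e : p + s • v - (p + r • v) = (s - r) • v := by module
    rw [e]
    exact hP _ _ h

theorem isClosed_directionSet {P : Space → Prop} (hP : ∀ (c : ℝ) v, P v → P (c • v))
    (hcl : IsClosed {v | P v}) :
    IsClosed {ℓ : Line | ∀ x ∈ ℓ.points, ∀ y ∈ ℓ.points, P (y - x)} := by
  rw [isClosed_iff]
  have : {x : Space × {v : Space // v ≠ 0} | ofPointDir x.1 x.2.1 x.2.2 ∈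
      {ℓ : Line | ∀ x ∈ ℓ.points, ∀ y ∈ ℓ.points, P (y - x)}} =
      (fun x => x.2.1) ⁻¹' {v | P v} := by
    ext ⟨p, v, hv⟩
    exact mem_directionSet hP
  rw [this]
  exact hcl.preimage (by fun_prop)

/-- A direction vector and an offset describe a line of the plane `z = 0`. -/
def IsPlaneLine (ℓ : Line) (v₀ v₁ c : ℝ) : Prop :=
  (v₀ ≠ 0 ∨ v₁ ≠ 0) ∧ ∀ x, x ∈ ℓ.points ↔ x 2 = 0 ∧ v₀ * x 1 - v₁ * x 0 - c = 0

theorem isPlaneLine_ofPointDir {p v : Space} (hv : v ≠ 0) (hp : p 2 = 0) (hv2 : v 2 = 0) :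
    IsPlaneLine (ofPointDir p v hv) (v 0) (v 1) (v 0 * p 1 - v 1 * p 0) := by
  have hv' : v 0 ≠ 0 ∨ v 1 ≠ 0 := by
    by_contra! h
    apply hv
    ext i
    fin_cases i
    · exact h.1
    · exact h.2
    · exact hv2
  refine ⟨hv', fun x => ?_⟩
  rw [mem_ofPointDir]
  constructor
  · rintro ⟨r, rfl⟩
    simp only [PiLp.add_apply, PiLp.smul_apply, smul_eq_mul, hp, hv2]
    constructor <;> ring
  · rintro ⟨h2, h⟩
    rcases hv' with h0 | h1
    · refine ⟨(x 0 - p 0) / v 0, ?_⟩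
      ext i
      fin_cases i
      · simp; field_simp; ring
      · simp; field_simp; linarith
      · simp [hp, hv2, h2]
    · refine ⟨(x 1 - p 1) / v 1, ?_⟩
      ext i
      fin_cases i
      · simp; field_simp; linarith
      · simp; field_simp; ring
      · simp [hp, hv2, h2]

theorem IsPlaneLine.neg {ℓ : Line} {v₀ v₁ c : ℝ} (h : IsPlaneLine ℓ v₀ v₁ c) :
    IsPlaneLine ℓ (-v₀) (-v₁) (-c) := by
  refine ⟨by simpa using h.1, fun x => (h.2 x).trans (and_congr_right fun _ => ?_)⟩
  constructor <;> intro h <;> linarith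

/-- The equation of a line is linear in `(v₀, v₁, c)`, so two lines are joined by interpolating
these triples as long as the direction does not vanish. -/
theorem joinedIn_of_isPlaneLine {T : Set Line} {ℓ ℓ' : Line} {v₀ v₁ c v₀' v₁' c' : ℝ}
    (h : IsPlaneLine ℓ v₀ v₁ c) (h' : IsPlaneLine ℓ' v₀' v₁' c')
    (hne : ∀ w w' : ℝ, 0 ≤ w → 0 ≤ w' → w + w' = 1 →
      (w * v₀ + w' * v₀' ≠ 0 ∨ w * v₁ + w' * v₁' ≠ 0))
    (hT : ∀ w w' : ℝ, 0 ≤ w → 0 ≤ w' → w + w' = 1 → ∀ ℓ'' : Line,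
      IsPlaneLine ℓ'' (w * v₀ + w' * v₀') (w * v₁ + w' * v₁') (w * c + w' * c') → ℓ'' ∈ T) :
    JoinedIn T ℓ ℓ' := by
  let V₀ : unitInterval → ℝ := fun τ => (1 - (τ : ℝ)) * v₀ + τ * v₀'
  let V₁ : unitInterval → ℝ := fun τ => (1 - (τ : ℝ)) * v₁ + τ * v₁'
  let C : unitInterval → ℝ := fun τ => (1 - (τ : ℝ)) * c + τ * c'
  have hV : ∀ τ, V₀ τ ≠ 0 ∨ V₁ τ ≠ 0 := fun τ =>
    hne _ _ (by linarith [τ.2.2]) τ.2.1 (by ring)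
  have hq : ∀ τ, V₀ τ ^ 2 + V₁ τ ^ 2 ≠ 0 := by
    intro τ h0
    rcases hV τ with h | h
    · have := pow_pos (abs_pos.2 h) 2
      rw [sq_abs] at this
      nlinarith [sq_nonneg (V₁ τ)]
    · have := pow_pos (abs_pos.2 h) 2
      rw [sq_abs] at this
      nlinarith [sq_nonneg (V₀ τ)]
  have hc0 : Continuous V₀ := by fun_prop
  have hc1 : Continuous V₁ := by fun_prop
  have hcC : Continuous C := by fun_prop
  -- The base point is the foot of the perpendicular from the origin, which varies continuously.
  let p : unitInterval → Space := fun τ =>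
    !₂[-(C τ * V₁ τ) / (V₀ τ ^ 2 + V₁ τ ^ 2), C τ * V₀ τ / (V₀ τ ^ 2 + V₁ τ ^ 2), 0]
  let v : unitInterval → Space := fun τ => !₂[V₀ τ, V₁ τ, 0]
  have hp : Continuous p := by
    refine (PiLp.continuous_toLp 2 _).comp (continuous_pi fun i => ?_)
    fin_cases i
    · exact (hcC.mul hc1).neg.div ((hc0.pow 2).add (hc1.pow 2)) hq
    · exact (hcC.mul hc0).div ((hc0.pow 2).add (hc1.pow 2)) hq
    · exact continuous_const
  have hv : Continuous v := by
    refine (PiLp.continuous_toLp 2 _).comp (continuous_pi fun i => ?_)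
    fin_cases i
    · exact hc0
    · exact hc1
    · exact continuous_const
  have hv0 : ∀ τ, v τ ≠ 0 := by
    intro τ h0
    have e0 := congrArg (fun x : Space => x 0) h0
    have e1 := congrArg (fun x : Space => x 1) h0
    simp [v] at e0 e1
    rcases hV τ with h | h
    · exact h e0
    · exact h e1
  have hplane : ∀ τ, IsPlaneLine (ofPointDir (p τ) (v τ) (hv0 τ)) (V₀ τ) (V₁ τ) (C τ) := by
    intro τ
    have e : V₀ τ * (C τ * V₀ τ / (V₀ τ ^ 2 + V₁ τ ^ 2)) -
        V₁ τ * (-(C τ * V₁ τ) / (V₀ τ ^ 2 + V₁ τ ^ 2)) = C τ := by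
      have := hq τ
      generalize V₀ τ = A at *
      generalize V₁ τ = B at *
      field_simp
      ring
    have h2 : IsPlaneLine (ofPointDir (p τ) (v τ) (hv0 τ)) (V₀ τ) (V₁ τ)
        (V₀ τ * (C τ * V₀ τ / (V₀ τ ^ 2 + V₁ τ ^ 2)) -
          V₁ τ * (-(C τ * V₁ τ) / (V₀ τ ^ 2 + V₁ τ ^ 2))) :=
      isPlaneLine_ofPointDir (p := p τ) (hv0 τ) rfl rfl
    rwa [e] at h2
  have huniq : ∀ {ℓ₁ ℓ₂ : Line} {a b d : ℝ}, IsPlaneLine ℓ₁ a b d → IsPlaneLine ℓ₂ a b d →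
      ℓ₁ = ℓ₂ := fun h₁ h₂ => ext_points (Set.ext fun x => (h₁.2 x).trans (h₂.2 x).symm)
  refine ⟨⟨⟨_, continuous_ofPointDir hp hv hv0⟩, ?_, ?_⟩, fun τ => ?_⟩
  · refine huniq (hplane 0) ?_
    simpa [V₀, V₁, C] using h
  · refine huniq (hplane 1) ?_
    simpa [V₀, V₁, C] using h'
  · exact hT _ _ (by linarith [τ.2.2]) τ.2.1 (by ring) _ (hplane τ)

end Line

/-- Transversals inside a plane: it suffices to cut at the directions of the segments, one of which
is vertical. -/
theorem coveredByPieces_plane {ι : Type} [Fintype ι] {a b : ι → Space} {J : ι → Set ℝ}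
    (hJ : ∀ i, Convex ℝ (J i)) (ha : ∀ i, a i 2 = 0) (hb : ∀ i, b i 2 = 0) {i₁ : ι}
    (h₁ : a i₁ 0 = b i₁ 0) :
    CoveredByPieces {ℓ | ℓ ∈ transversals (fun i => segmentOf (a i) (b i) (J i)) ∧
      ∀ x ∈ ℓ.points, x 2 = 0} (Fintype.card ι) := by
  classical
  set T := {ℓ | ℓ ∈ transversals (fun i => segmentOf (a i) (b i) (J i)) ∧
      ∀ x ∈ ℓ.points, x 2 = 0} with hT
  have hmeet : ∀ {ℓ : Line} {v₀ v₁ c : ℝ}, ℓ.IsPlaneLine v₀ v₁ c → ∀ i,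
      ((ℓ.points ∩ segmentOf (a i) (b i) (J i)).Nonempty ↔ ∃ s ∈ J i,
        (1 - s) * (v₀ * a i 1 - v₁ * a i 0 - c) + s * (v₀ * b i 1 - v₁ * b i 0 - c) = 0) := by
    intro ℓ v₀ v₁ c h i
    constructor
    · rintro ⟨_, hx, s, hs, rfl⟩
      have := ((h.2 _).1 hx).2
      simp only [PiLp.add_apply, PiLp.smul_apply, smul_eq_mul] at this
      exact ⟨s, hs, by linear_combination this⟩
    · rintro ⟨s, hs, e⟩
      refine ⟨_, (h.2 _).2 ⟨?_, ?_⟩, s, hs, rfl⟩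
      · simp [ha, hb]
      · simp only [PiLp.add_apply, PiLp.smul_apply, smul_eq_mul]
        linear_combination e
  -- These are the slopes of the other segments; further vertical ones contribute the harmless value
  -- `0`. Together with the vertical direction of `i₁` there are at most `n` cuts on the circle of
  -- directions, hence at most `n` arcs.
  let F : Finset ℝ := (Finset.univ.erase i₁).image fun i => (a i 1 - b i 1) / (a i 0 - b i 0)
  have hF : F.card + 1 ≤ Fintype.card ι := by
    have h1 : F.card ≤ (Finset.univ.erase i₁).card := Finset.card_image_le
    rw [Finset.card_erase_of_mem (Finset.mem_univ _), Finset.card_univ] at h1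
    have : 0 < Fintype.card ι := Fintype.card_pos_iff.2 ⟨i₁⟩
    omega
  -- The sign `σ g` records the side of slope `g` on which the oriented direction lies. Equal sides
  -- give the sign condition for interpolating the two equations.
  have hjoin : ∀ σ : ℝ → ℝ, (∀ g, σ g * σ g = 1) → ∀ ℓ ∈ T, ∀ ℓ' ∈ T,
      (∃ v₀ v₁ c, ℓ.IsPlaneLine v₀ v₁ c ∧ 0 ≤ v₀ ∧ ∀ g ∈ F, 0 ≤ σ g * (v₁ - g * v₀)) →
      (∃ v₀ v₁ c, ℓ'.IsPlaneLine v₀ v₁ c ∧ 0 ≤ v₀ ∧ ∀ g ∈ F, 0 ≤ σ g * (v₁ - g * v₀)) →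
      JoinedIn T ℓ ℓ' := by
    rintro σ hσ ℓ hℓ ℓ' hℓ' ⟨v₀, v₁, c, hr, hv, hg⟩ ⟨v₀', v₁', c', hr', hv', hg'⟩
    -- Two vertical directions may be opposite, and interpolation would fail; but both lines then
    -- pass through the vertical segment `i₁` and coincide.
    by_cases hvert : v₀ = 0 ∧ v₀' = 0
    · obtain ⟨rfl, rfl⟩ := hvert
      have hpts : ∀ {ℓ : Line} {v₁ c : ℝ}, ℓ ∈ T → ℓ.IsPlaneLine 0 v₁ c → ∀ x,
          (x ∈ ℓ.points ↔ x 2 = 0 ∧ x 0 = a i₁ 0) := by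
        intro ℓ v₁ c hℓ hr x
        obtain ⟨s, -, e⟩ := (hmeet hr i₁).1 (hℓ.1 i₁)
        rw [← h₁] at e
        have hv1 : v₁ ≠ 0 := by simpa using hr.1
        rw [hr.2]
        refine and_congr_right fun _ => ⟨fun h => ?_, fun h => ?_⟩
        · have : v₁ * (x 0 - a i₁ 0) = 0 := by linarith
          linarith [(mul_eq_zero.1 this).resolve_left hv1]
        · rw [h]; linarith
      have : ℓ = ℓ' := Line.ext_points (Set.ext fun x =>
        (hpts hℓ hr x).trans (hpts hℓ' hr' x).symm)
      rw [← this]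
      exact JoinedIn.refl hℓ
    · refine Line.joinedIn_of_isPlaneLine hr hr' ?_ ?_
      · intro w w' hw hw' hww
        by_contra! h0
        have z1 : w * v₀ = 0 := by nlinarith [mul_nonneg hw hv, mul_nonneg hw' hv']
        have z2 : w' * v₀' = 0 := by nlinarith [mul_nonneg hw hv, mul_nonneg hw' hv']
        rcases mul_eq_zero.1 z1 with rfl | rfl
        · obtain rfl : w' = 1 := by linarith
          rcases hr'.1 with h | h
          · exact h (by simpa using h0.1)
          · exact h (by simpa using h0.2)
        · rcases mul_eq_zero.1 z2 with rfl | rfl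
          · obtain rfl : w = 1 := by linarith
            rcases hr.1 with h | h
            · exact h rfl
            · exact h (by simpa using h0.2)
          · exact hvert ⟨rfl, rfl⟩
      · intro w w' hw hw' hww ℓ'' hr''
        refine ⟨fun i => (hmeet hr'' i).2 ?_, fun x hx => ((hr''.2 x).1 hx).1⟩
        have := exists_affine_zero_combination (hJ i) (w := w) (w' := w') ?_
          ((hmeet hr i).1 (hℓ.1 i)) ((hmeet hr' i).1 (hℓ'.1 i)) hw hw'
        · obtain ⟨s, hs, e⟩ := this
          exact ⟨s, hs, by linear_combination e⟩
        · by_cases hx : a i 0 = b i 0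
          · rw [hx]
            have := mul_nonneg (mul_nonneg hv hv') (mul_self_nonneg (a i 1 - b i 1))
            linarith
          · have hi : i ≠ i₁ := by
              rintro rfl
              exact hx h₁
            have hd : a i 0 - b i 0 ≠ 0 := sub_ne_zero.2 hx
            have hmem : (a i 1 - b i 1) / (a i 0 - b i 0) ∈ F :=
              Finset.mem_image_of_mem _ (Finset.mem_erase.2 ⟨hi, Finset.mem_univ _⟩)
            have p1 := hg _ hmem
            have p2 := hg' _ hmem
            set g := (a i 1 - b i 1) / (a i 0 - b i 0) with hgdef
            have hgm : g * (a i 0 - b i 0) = a i 1 - b i 1 := div_mul_cancel₀ _ hd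
            have hn := mul_nonneg (mul_nonneg p1 p2) (mul_self_nonneg (a i 0 - b i 0))
            have e1 : ∀ v₀ v₁ c : ℝ, v₀ * a i 1 - v₁ * a i 0 - c - (v₀ * b i 1 - v₁ * b i 0 - c) =
                -(v₁ - g * v₀) * (a i 0 - b i 0) := fun v₀ v₁ c => by
              linear_combination -v₀ * hgm
            rw [e1, e1]
            have e2 : -(v₁ - g * v₀) * (a i 0 - b i 0) * (-(v₁' - g * v₀') * (a i 0 - b i 0)) =
              σ g * (v₁ - g * v₀) * (σ g * (v₁' - g * v₀')) *
                ((a i 0 - b i 0) * (a i 0 - b i 0)) := by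
              linear_combination (-(v₁ - g * v₀) * (v₁' - g * v₀') * (a i 0 - b i 0) ^ 2) * hσ g
            rw [e2]
            exact hn
  have hrep : ∀ ℓ ∈ T, ∃ p v, ∃ hv : v ≠ 0, ℓ = Line.ofPointDir p v hv ∧
      ℓ.IsPlaneLine (v 0) (v 1) (v 0 * p 1 - v 1 * p 0) := by
    intro ℓ hℓ
    obtain ⟨p, v, hv, rfl⟩ := ℓ.exists_eq_ofPointDir
    have hp2 := hℓ.2 p (Line.mem_ofPointDir.2 ⟨0, by simp⟩)
    have hv2 := hℓ.2 (p + v) (Line.mem_ofPointDir.2 ⟨1, by simp⟩)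
    refine ⟨p, v, hv, rfl, Line.isPlaneLine_ofPointDir hv hp2 ?_⟩
    simpa [hp2] using hv2
  -- The arc of `f` consists of the slopes from the preceding one up to `f`, and `none` of those
  -- above all of `F`. The product of two factors `v 1 - g * v 0`, rather than one with `v 0`,
  -- excludes the vertical direction from every arc of `f` except the lowest.
  let P : Option F → Space → Prop := fun o v => o.elim (∀ g ∈ F, 0 ≤ (v 1 - g * v 0) * v 0)
    (fun f => (v 1 - f.1 * v 0) * v 0 ≤ 0 ∧
      ∀ g ∈ F, g < f.1 → (v 1 - f.1 * v 0) * (v 1 - g * v 0) ≤ 0)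
  have hscale : ∀ o (k : ℝ) v, P o v → P o (k • v) := by
    have hk : ∀ k : ℝ, 0 ≤ k * k := mul_self_nonneg
    rintro (_ | f) k v h
    · intro g hg
      have := mul_nonneg (hk k) (h g hg)
      simp only [PiLp.smul_apply, smul_eq_mul]
      linarith
    · refine ⟨?_, fun g hg hlt => ?_⟩
      · have := mul_nonneg (hk k) (neg_nonneg.2 h.1)
        simp only [PiLp.smul_apply, smul_eq_mul]
        linarith
      · have := mul_nonneg (hk k) (neg_nonneg.2 (h.2 g hg hlt))
        simp only [PiLp.smul_apply, smul_eq_mul]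
        linarith
  have hclosed : ∀ o, IsClosed {v | P o v} := by
    rintro (_ | f)
    · simp only [P, Option.elim, Set.ofPred_forall]
      exact isClosed_biInter fun g _ => isClosed_le (by fun_prop) (by fun_prop)
    · simp only [P, Option.elim, Set.ofPred_and, Set.ofPred_forall]
      exact (isClosed_le (by fun_prop) (by fun_prop)).inter (isClosed_iInter fun g =>
        isClosed_iInter fun _ => isClosed_iInter fun _ => isClosed_le (by fun_prop) (by fun_prop))
  refine ⟨Option F, inferInstance,
    fun o => {ℓ : Line | ∀ x ∈ ℓ.points, ∀ y ∈ ℓ.points, P o (y - x)}, by simpa using hF,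
    fun o => Line.isClosed_directionSet (hscale o) (hclosed o), ?_, ?_⟩
  · intro ℓ hℓ
    obtain ⟨p, v, hv, rfl, hr⟩ := hrep ℓ hℓ
    have hmem := fun o => Line.mem_directionSet (p := p) (hv := hv) (hscale o)
    refine Set.mem_iUnion.2 ?_
    simp only [hmem]
    by_cases hall : ∀ g ∈ F, 0 ≤ (v 1 - g * v 0) * v 0
    · exact ⟨none, hall⟩
    · push Not at hall
      obtain ⟨g₀, hg₀, hlt₀⟩ := hall
      have hne : (F.filter fun g => (v 1 - g * v 0) * v 0 ≤ 0).Nonempty :=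
        ⟨g₀, by simp [hg₀, hlt₀.le]⟩
      obtain ⟨f, hf, hmin⟩ := Finset.exists_min_image _ id hne
      simp only [Finset.mem_filter, id] at hf hmin
      refine ⟨some ⟨f, hf.1⟩, hf.2, fun g hg hlt => ?_⟩
      have hv0 : v 0 ≠ 0 := by
        intro h0
        rw [h0] at hlt₀
        simp at hlt₀
      have hgpos : 0 < (v 1 - g * v 0) * v 0 := by
        by_contra! hle
        linarith [hmin g ⟨hg, hle⟩]
      have hprod : ((v 1 - f * v 0) * (v 1 - g * v 0)) * (v 0 * v 0) ≤ 0 := by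
        have := mul_nonneg (neg_nonneg.2 hf.2) hgpos.le
        linarith
      have hsq : 0 < v 0 * v 0 := mul_self_pos.2 hv0
      by_contra! hpos
      linarith [mul_pos hpos hsq]
  · intro o
    -- orient the direction vectors consistently
    have horient : ∃ σ : ℝ → ℝ, (∀ g, σ g * σ g = 1) ∧ ∀ v : Space, (v 0 ≠ 0 ∨ v 1 ≠ 0) → P o v →
        ∃ ε : ℝ, (ε = 1 ∨ ε = -1) ∧ 0 ≤ ε * v 0 ∧
          ∀ g ∈ F, 0 ≤ σ g * (ε * v 1 - g * (ε * v 0)) := by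
      rcases o with _ | f
      · refine ⟨fun _ => 1, fun _ => by norm_num, fun v hv h => ?_⟩
        have h' : ∀ g ∈ F, 0 ≤ (v 1 - g * v 0) * v 0 := h
        rcases lt_trichotomy (v 0) 0 with h0 | h0 | h0
        · refine ⟨-1, Or.inr rfl, by linarith, fun g hg => ?_⟩
          by_contra! hlt
          nlinarith [h' g hg]
        · rw [h0]
          rcases le_total 0 (v 1) with h1 | h1
          · exact ⟨1, Or.inl rfl, by simp, fun g hg => by linarith⟩
          · exact ⟨-1, Or.inr rfl, by simp, fun g hg => by linarith⟩
        · refine ⟨1, Or.inl rfl, by linarith, fun g hg => ?_⟩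
          by_contra! hlt
          nlinarith [h' g hg]
      · refine ⟨fun g => if g < f.1 then 1 else -1, fun g => ?_, fun v hv h => ?_⟩
        · dsimp only
          split_ifs <;> norm_num
        have key : ∀ V₀ V₁ : ℝ, 0 < V₀ → (V₁ - f.1 * V₀) * V₀ ≤ 0 →
            (∀ g ∈ F, g < f.1 → (V₁ - f.1 * V₀) * (V₁ - g * V₀) ≤ 0) →
            ∀ g ∈ F, 0 ≤ (if g < f.1 then (1 : ℝ) else -1) * (V₁ - g * V₀) := by
          intro V₀ V₁ h0 h1 h2 g hg
          have h1' : V₁ - f.1 * V₀ ≤ 0 := by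
            by_contra! hlt
            nlinarith
          split_ifs with hgf
          · have : 0 < (f.1 - g) * V₀ := mul_pos (by linarith) h0
            by_contra! hlt
            have hlt' : V₁ - g * V₀ < 0 := by linarith
            have : V₁ - f.1 * V₀ < 0 := by linarith
            linarith [h2 g hg hgf, mul_pos_of_neg_of_neg this hlt']
          · have : 0 ≤ (g - f.1) * V₀ := mul_nonneg (by linarith) h0.le
            linarith
        obtain ⟨ha', hb'⟩ : (v 1 - f.1 * v 0) * v 0 ≤ 0 ∧
          ∀ g ∈ F, g < f.1 → (v 1 - f.1 * v 0) * (v 1 - g * v 0) ≤ 0 := h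
        rcases lt_trichotomy (v 0) 0 with h0 | h0 | h0
        · refine ⟨-1, Or.inr rfl, by linarith, key _ _ (by linarith) (by linarith) ?_⟩
          intro g hg hlt
          linarith [hb' g hg hlt]
        · have h1 : v 1 ≠ 0 := by
            rcases hv with h | h
            · exact absurd h0 h
            · exact h
          -- A vertical direction in the arc of `f` forces `f` to be the least slope. All signs are
          -- then `-1`, and the direction is oriented downwards.
          have hno : ∀ g ∈ F, ¬ g < f.1 := by
            intro g hg hlt
            have := hb' g hg hlt
            rw [h0] at this
            have := mul_self_pos.2 h1
            linarith
          rcases le_total 0 (v 1) with h1 | h1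
          · refine ⟨-1, Or.inr rfl, by rw [h0]; simp, fun g hg => ?_⟩
            simp only [if_neg (hno g hg), h0]; linarith
          · refine ⟨1, Or.inl rfl, by rw [h0]; simp, fun g hg => ?_⟩
            simp only [if_neg (hno g hg), h0]; linarith
        · refine ⟨1, Or.inl rfl, by linarith, key _ _ (by linarith) (by linarith) ?_⟩
          intro g hg hlt
          linarith [hb' g hg hlt]
    obtain ⟨σ, hσ, hor⟩ := horient
    have hrep' : ∀ ℓ ∈ T ∩ {ℓ : Line | ∀ x ∈ ℓ.points, ∀ y ∈ ℓ.points, P o (y - x)},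
        ∃ v₀ v₁ c, ℓ.IsPlaneLine v₀ v₁ c ∧ 0 ≤ v₀ ∧ ∀ g ∈ F, 0 ≤ σ g * (v₁ - g * v₀) := by
      rintro ℓ ⟨hℓ, hℓo⟩
      obtain ⟨p, v, hv, rfl, hr⟩ := hrep ℓ hℓ
      rw [Line.mem_directionSet (hscale o)] at hℓo
      obtain ⟨ε, rfl | rfl, e0, eg⟩ := hor v hr.1 hℓo
      · refine ⟨_, _, _, hr, by linarith, fun g hg => ?_⟩
        simpa using eg g hg
      · refine ⟨_, _, _, hr.neg, by linarith, fun g hg => ?_⟩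
        simpa using eg g hg
    exact fun ℓ hℓ ℓ' hℓ' => hjoin σ hσ ℓ hℓ.1 ℓ' hℓ'.1 (hrep' ℓ hℓ) (hrep' ℓ' hℓ')

/-- The part of a segment in a plane. -/
theorem segmentOf_inter_plane {a b : Space} {J : Set ℝ} (hJ : Convex ℝ J) (n : Space →ₗ[ℝ] ℝ)
    (c : ℝ) (hne : (segmentOf a b J ∩ {x | n x = c}).Nonempty) :
    ∃ (a' b' : Space) (J' : Set ℝ), Convex ℝ J' ∧ J'.Nonempty ∧ n a' = c ∧ n b' = c ∧
      segmentOf a b J ∩ {x | n x = c} = segmentOf a' b' J' := by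
  obtain ⟨_, ⟨s, hs, rfl⟩, hx⟩ := hne
  have hform : ∀ s : ℝ, n ((1 - s) • a + s • b) = n a + s * (n b - n a) := fun s => by
    simp; ring
  have hx' : n a + s * (n b - n a) = c := by rw [← hform]; exact hx
  by_cases hab : n a = n b
  · have ha : n a = c := by rw [← hx', hab]; ring
    refine ⟨a, b, J, hJ, ⟨s, hs⟩, ha, by rw [← hab, ha], Set.inter_eq_left.2 ?_⟩
    rintro _ ⟨s', -, rfl⟩
    show n _ = c
    rw [hform, ← hab, ha]; ring
  -- A segment crossing the plane leaves a single point, written as a degenerate segment.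
  · refine ⟨(1 - s) • a + s • b, (1 - s) • a + s • b, Set.univ, convex_univ, ⟨0, trivial⟩, hx, hx,
      ?_⟩
    ext y
    constructor
    · rintro ⟨⟨s', hs', rfl⟩, hy⟩
      have hy' : n a + s' * (n b - n a) = c := by rw [← hform]; exact hy
      have : (s' - s) * (n b - n a) = 0 := by linarith
      have hss : s' = s := by
        rcases mul_eq_zero.1 this with h | h
        · linarith
        · exact absurd (by linarith) hab
      exact ⟨0, trivial, by simp [hss]⟩
    · rintro ⟨r, -, rfl⟩
      have : (1 - r) • ((1 - s) • a + s • b) + r • ((1 - s) • a + s • b) =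
          (1 - s) • a + s • b := by module
      dsimp only
      rw [this]
      exact ⟨⟨s, hs, rfl⟩, hx⟩

/-- Completion of a direction of a plane to a coordinate system with that plane as `z = 0`. -/
theorem exists_plane_frame {n : Space →ₗ[ℝ] ℝ} (hn : n ≠ 0) {d : Space} (hd : d ≠ 0)
    (hnd : n d = 0) :
    ∃ e f : Space, n e = 0 ∧ n f ≠ 0 ∧ LinearIndependent ℝ ![e, d, f] := by
  obtain ⟨f, hf⟩ : ∃ f, n f ≠ 0 := by
    by_contra! h
    exact hn (LinearMap.ext h)
  have hker : Module.finrank ℝ (LinearMap.ker n) = 2 := by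
    have h1 := n.finrank_range_add_finrank_ker
    rw [LinearMap.range_eq_top.2 (LinearMap.surjective hn), finrank_top] at h1
    simp at h1
    omega
  obtain ⟨e, he, hed⟩ : ∃ e ∈ LinearMap.ker n, e ∉ Submodule.span ℝ {d} := by
    by_contra! h
    have h2 : Module.finrank ℝ (LinearMap.ker n) ≤ Module.finrank ℝ (Submodule.span ℝ {d}) :=
      Submodule.finrank_mono (fun x hx => h x hx)
    rw [hker, finrank_span_singleton hd] at h2
    omega
  refine ⟨e, f, he, hf, linearIndependent_three.2 fun x y z h => ?_⟩
  have hz : z = 0 := by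
    have := congrArg n h
    simp [LinearMap.mem_ker.1 he, hnd] at this
    exact this.resolve_right hf
  subst hz
  have hx : x = 0 := by
    by_contra hx
    apply hed
    rw [Submodule.mem_span_singleton]
    refine ⟨-(x⁻¹ * y), ?_⟩
    have h3 : y • d = -(x • e) := by
      rw [zero_smul, add_zero] at h
      exact eq_neg_of_add_eq_zero_right h
    rw [neg_smul, mul_smul, h3, smul_neg, neg_neg, smul_smul, inv_mul_cancel₀ hx, one_smul]
  subst hx
  refine ⟨rfl, ?_, rfl⟩
  simpa [hd] using h

/-! ### Pairwise coplanar segments and the upper bound -/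

section

variable {ι : Type}

/-- Only the traces of the segments on the plane matter, and these are segments. If all traces are
points, two of them differ and determine the line; otherwise a nondegenerate trace serves as the
vertical segment. -/
theorem coveredByPieces_of_forall_subset_plane [Fintype ι] [Nonempty ι] {s : ι → Set Space}
    (hs : ∀ i, ∃ (a b : Space) (J : Set ℝ), Convex ℝ J ∧ J.Nonempty ∧ s i = segmentOf a b J)
    (hcommon : ¬ ∃ x, ∀ i, x ∈ s i) {n : Space →ₗ[ℝ] ℝ} (hn : n ≠ 0) {c : ℝ}
    (hplane : ∀ ℓ ∈ transversals s, ∀ x ∈ ℓ.points, n x = c) :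
    CoveredByPieces (transversals s) (Fintype.card ι) := by
  classical
  have hpos : 1 ≤ Fintype.card ι := Fintype.card_pos
  rcases (transversals s).eq_empty_or_nonempty with hemp | ⟨ℓ₀, hℓ₀⟩
  · rw [hemp]
    exact CoveredByPieces.of_finite Set.finite_empty (by simp)
  have hinter : ∀ i, ∃ (a b : Space) (J : Set ℝ), Convex ℝ J ∧ J.Nonempty ∧ n a = c ∧ n b = c ∧
      s i ∩ {x | n x = c} = segmentOf a b J := by
    intro i
    obtain ⟨a, b, J, hJ, -, h⟩ := hs i
    rw [h]
    refine segmentOf_inter_plane hJ n c ?_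
    rw [← h]
    obtain ⟨x, hx, hxs⟩ := hℓ₀ i
    exact ⟨x, hxs, hplane _ hℓ₀ x hx⟩
  choose a b J hJ hJne ha hb hseg using hinter
  have hT : transversals s = {ℓ | ℓ ∈ transversals (fun i => segmentOf (a i) (b i) (J i)) ∧
      ∀ x ∈ ℓ.points, n x = c} := by
    ext ℓ
    constructor
    · intro hℓ
      refine ⟨fun i => ?_, hplane ℓ hℓ⟩
      obtain ⟨x, hx, hxs⟩ := hℓ i
      dsimp only
      rw [← hseg]
      exact ⟨x, hx, hxs, hplane ℓ hℓ x hx⟩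
    · rintro ⟨hℓ, -⟩ i
      obtain ⟨x, hx, hxs⟩ := hℓ i
      dsimp only at hxs
      rw [← hseg] at hxs
      exact ⟨x, hx, hxs.1⟩
  by_cases hdeg : ∀ i, a i = b i
  · have hmem : ∀ i, a i ∈ s i ∧ ∀ ℓ ∈ transversals s, a i ∈ ℓ.points := by
      have hsing : ∀ i, ∀ x ∈ segmentOf (a i) (b i) (J i), x = a i := by
        rintro i _ ⟨r, -, rfl⟩
        dsimp only
        rw [← hdeg]; module
      intro i
      constructor
      · obtain ⟨r, hr⟩ := hJne i
        have : (1 - r) • a i + r • b i ∈ s i ∩ {x | n x = c} := by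
          rw [hseg]; exact ⟨r, hr, rfl⟩
        have e : (1 - r) • a i + r • b i = a i := hsing i _ ⟨r, hr, rfl⟩
        rw [e] at this
        exact this.1
      · intro ℓ hℓ
        rw [hT] at hℓ
        obtain ⟨x, hx, hxs⟩ := hℓ.1 i
        rwa [hsing i x hxs] at hx
    obtain ⟨i₀⟩ := ‹Nonempty ι›
    have hex : ∃ j, a j ≠ a i₀ := by
      by_contra! hall
      exact hcommon ⟨a i₀, fun i => hall i ▸ (hmem i).1⟩
    obtain ⟨j, hj⟩ := hex
    refine (CoveredByPieces.of_joinedIn fun ℓ hℓ ℓ' hℓ' => ?_).mono hpos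
    have : ℓ = ℓ' := Line.eq_of_mem hj ((hmem j).2 ℓ hℓ) ((hmem i₀).2 ℓ hℓ)
      ((hmem j).2 ℓ' hℓ') ((hmem i₀).2 ℓ' hℓ')
    rw [← this]
    exact JoinedIn.refl hℓ
  · obtain ⟨i₁, hi₁⟩ := not_forall.1 hdeg
    have hd : b i₁ - a i₁ ≠ 0 := sub_ne_zero.2 (Ne.symm hi₁)
    obtain ⟨e, f, he, hf, hli⟩ := exists_plane_frame hn hd (by rw [map_sub, ha, hb, sub_self])
    obtain ⟨φ, hφ⟩ := exists_frame (a i₁) hli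
    have hz : ∀ x, φ x 2 = 0 ↔ n x = c := by
      intro x
      have h1 := exists_coords φ (a i₁) hφ x
      have h2 : n x = c + φ x 2 * n f := by
        conv_lhs => rw [h1]
        simp [he, ha, hb]
      rw [h2]
      constructor
      · intro h; rw [h]; ring
      · intro h
        have : φ x 2 * n f = 0 := by linarith
        exact (mul_eq_zero.1 this).resolve_right hf
    have ha1 : φ (a i₁) = !₂[0, 0, 0] := by rw [← hφ]; simp
    have hb1 : φ (b i₁) = !₂[0, 1, 0] := by rw [← hφ]; congr 1; module
    have hcov := coveredByPieces_plane (a := fun i => φ (a i)) (b := fun i => φ (b i)) hJ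
      (fun i => (hz _).2 (ha i)) (fun i => (hz _).2 (hb i)) (i₁ := i₁) (by simp [ha1, hb1])
    apply CoveredByPieces.of_affineEquiv φ
    convert hcov using 1
    ext ℓ
    have hback : ∀ r : ι → Set Space, ∀ ℓ : Line,
        ℓ ∈ transversals (fun i => φ '' r i) ↔ ℓ.map φ.symm ∈ transversals r := by
      intro r ℓ
      refine forall_congr' fun i => ?_
      rw [Line.points_map]
      constructor
      · rintro ⟨_, hx, y, hy, rfl⟩
        exact ⟨y, ⟨_, hx, by simp⟩, hy⟩
      · rintro ⟨_, ⟨x, hx, rfl⟩, hy⟩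
        exact ⟨x, hx, _, hy, by simp⟩
    have hz' : (∀ x ∈ ℓ.points, x 2 = 0) ↔ ∀ x ∈ (ℓ.map φ.symm).points, n x = c := by
      rw [Line.points_map, Set.forall_mem_image]
      refine forall₂_congr fun x _ => ?_
      rw [← hz]; simp
    rw [hback, hT]
    simp only [← segmentOf_image]
    change _ ↔ ℓ ∈ transversals _ ∧ _
    rw [hback, hz']
    rfl

/-- Two nonparallel transversals to pairwise coplanar sets without a common point meet. -/
theorem exists_mem_of_not_parallel {s : ι → Set Space} (hcommon : ¬ ∃ x, ∀ i, x ∈ s i)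
    (hskew : ∀ i j, ∀ x ∈ s i, ∀ y ∈ s i, ∀ x' ∈ s j, ∀ y' ∈ s j,
      ¬ LinearIndependent ℝ ![y - x, y' - x', x' - x]) {p v p' v' : Space} {hv : v ≠ 0}
    {hv' : v' ≠ 0} (hℓ : Line.ofPointDir p v hv ∈ transversals s)
    (hℓ' : Line.ofPointDir p' v' hv' ∈ transversals s)
    (hvv : ∀ x y : ℝ, x • v + y • v' = 0 → x = 0 ∧ y = 0) :
    ∃ q, q ∈ (Line.ofPointDir p v hv).points ∧ q ∈ (Line.ofPointDir p' v' hv').points := by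
  by_cases hli : LinearIndependent ℝ ![v, v', p' - p]
  · exfalso
    rw [linearIndependent_three] at hli
    have h1 : ∀ i, ∃ t : ℝ, p + t • v ∈ s i := by
      intro i
      obtain ⟨x, hx, hxs⟩ := hℓ i
      obtain ⟨t, rfl⟩ := Line.mem_ofPointDir.1 hx
      exact ⟨t, hxs⟩
    have h2 : ∀ i, ∃ t : ℝ, p' + t • v' ∈ s i := by
      intro i
      obtain ⟨x, hx, hxs⟩ := hℓ' i
      obtain ⟨t, rfl⟩ := Line.mem_ofPointDir.1 hx
      exact ⟨t, hxs⟩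
    choose t ht using h1
    choose u hu using h2
    -- Segments meeting two skew lines in four distinct points would themselves be skew. So any two
    -- segments share a point on one of the two lines.
    have hshare : ∀ i j, t i = t j ∨ u i = u j := by
      intro i j
      by_contra! hne
      refine hskew i j _ (ht i) _ (hu i) _ (ht j) _ (hu j) (linearIndependent_three.2 ?_)
      intro α β γ h
      have hcomb : (-α * t i - β * t j + γ * (t j - t i)) • v + (α * u i + β * u j) • v' +
          (α + β) • (p' - p) = 0 := by
        rw [← h]; module
      obtain ⟨e1, e2, e3⟩ := hli _ _ _ hcomb
      have hα : α = 0 := by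
        have : α * (u i - u j) = 0 := by linear_combination e2 - u j * e3
        exact (mul_eq_zero.1 this).resolve_right (sub_ne_zero.2 hne.2)
      have hβ : β = 0 := by linarith
      subst hα
      subst hβ
      refine ⟨rfl, rfl, ?_⟩
      have : γ * (t j - t i) = 0 := by linarith
      exact (mul_eq_zero.1 this).resolve_right (sub_ne_zero.2 hne.1.symm)
    by_cases hall : ∀ i j, t i = t j
    · rcases isEmpty_or_nonempty ι with hE | ⟨⟨i₀⟩⟩
      · exact hcommon ⟨0, fun i => (hE.false i).elim⟩
      · exact hcommon ⟨p + t i₀ • v, fun i => hall i i₀ ▸ ht i⟩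
    -- If `i` and `j` differ on the first line, they agree on the second; any `k` differs from one
    -- of them on the first line, so all agree on the second.
    · push Not at hall
      obtain ⟨i, j, hij⟩ := hall
      have huij : u i = u j := (hshare i j).resolve_left hij
      refine hcommon ⟨p' + u i • v', fun k => ?_⟩
      have : u k = u i := by
        rcases hshare k i with h | h
        · rcases hshare k j with h' | h'
          · exact absurd (h.symm.trans h') hij
          · rw [h', huij]
        · exact h
      rw [← this]
      exact hu k
  · rw [linearIndependent_three] at hli
    push Not at hli
    obtain ⟨x, y, z, h, hne⟩ := hli
    have hz : z ≠ 0 := by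
      rintro rfl
      rw [zero_smul, add_zero] at h
      obtain ⟨rfl, rfl⟩ := hvv x y h
      exact hne rfl rfl rfl
    refine ⟨p + (-(x / z)) • v, Line.mem_ofPointDir.2 ⟨_, rfl⟩,
      Line.mem_ofPointDir.2 ⟨y / z, ?_⟩⟩
    have : z⁻¹ • (x • v + y • v' + z • (p' - p)) = 0 := by rw [h, smul_zero]
    rw [smul_add, smul_add, smul_smul, smul_smul, smul_smul, inv_mul_cancel₀ hz, one_smul] at this
    have h3 : p' + (y / z) • v' - (p + (-(x / z)) • v) = 0 := by
      rw [← this, div_eq_inv_mul, div_eq_inv_mul]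
      module
    exact (sub_eq_zero.1 h3).symm

theorem exists_linearMap_eq_zero (v w : Space) : ∃ n : Space →ₗ[ℝ] ℝ, n ≠ 0 ∧ n v = 0 ∧ n w = 0 := by
  have hlt : Submodule.span ℝ {v, w} < ⊤ := by
    rw [lt_top_iff_ne_top]
    intro h
    have h1 : Module.finrank ℝ (Submodule.span ℝ (({v, w} : Finset Space) : Set Space)) ≤ 2 :=
      (finrank_span_finset_le_card _).trans Finset.card_le_two
    rw [Finset.coe_pair, h, finrank_top] at h1
    simp at h1
  obtain ⟨n, hn, hle⟩ := Submodule.exists_le_ker_of_lt_top _ hlt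
  exact ⟨n, hn, hle (Submodule.subset_span (by simp)), hle (Submodule.subset_span (by simp))⟩

/-- The transversals to pairwise coplanar segments without a common point lie in a plane. -/
theorem exists_plane_of_coplanar [Nonempty ι] {s : ι → Set Space}
    (hs : ∀ i, ∃ (a b : Space) (J : Set ℝ), s i = segmentOf a b J)
    (hcommon : ¬ ∃ x, ∀ i, x ∈ s i)
    (hskew : ∀ i j, ∀ x ∈ s i, ∀ y ∈ s i, ∀ x' ∈ s j, ∀ y' ∈ s j,
      ¬ LinearIndependent ℝ ![y - x, y' - x', x' - x]) :
    ∃ n : Space →ₗ[ℝ] ℝ, n ≠ 0 ∧ ∃ c : ℝ, ∀ ℓ ∈ transversals s, ∀ x ∈ ℓ.points, n x = c := by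
  rcases (transversals s).eq_empty_or_nonempty with hemp | ⟨ℓ₁, hℓ₁⟩
  · obtain ⟨n, hn, -⟩ := exists_linearMap_eq_zero 0 0
    exact ⟨n, hn, 0, fun ℓ hℓ => by rw [hemp] at hℓ; exact hℓ.elim⟩
  obtain ⟨p₁, v₁, hv₁, rfl⟩ := ℓ₁.exists_eq_ofPointDir
  by_cases hpar : ∀ ℓ ∈ transversals s, ∃ p, ℓ = Line.ofPointDir p v₁ hv₁
  -- Parallel transversals all lie in the plane through one segment containing their common
  -- direction.
  · obtain ⟨i₀⟩ := ‹Nonempty ι›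
    obtain ⟨a, b, J, hab⟩ := hs i₀
    obtain ⟨n, hn, hn1, hn2⟩ := exists_linearMap_eq_zero v₁ (b - a)
    refine ⟨n, hn, n a, fun ℓ hℓ x hx => ?_⟩
    obtain ⟨y, hy, hys⟩ := hℓ i₀
    obtain ⟨p, rfl⟩ := hpar ℓ hℓ
    rw [hab] at hys
    obtain ⟨r, -, rfl⟩ := hys
    obtain ⟨t, rfl⟩ := Line.mem_ofPointDir.1 hx
    obtain ⟨t', ht'⟩ := Line.mem_ofPointDir.1 hy
    have hy2 : n ((1 - r) • a + r • b) = n a := by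
      have : (1 - r) • a + r • b = a + r • (b - a) := by module
      rw [this, map_add, map_smul, hn2, smul_zero, add_zero]
    have := congrArg n ht'
    dsimp only at this
    rw [hy2, map_add, map_smul, hn1, smul_zero, add_zero] at this
    rw [map_add, map_smul, hn1, smul_zero, add_zero, this]
  push Not at hpar
  obtain ⟨ℓ₂, hℓ₂, hne⟩ := hpar
  obtain ⟨p₂, v₂, hv₂, rfl⟩ := ℓ₂.exists_eq_ofPointDir
  have hindep : ∀ {v w : Space}, v ≠ 0 → (∀ k : ℝ, w ≠ k • v) →
      ∀ x y : ℝ, x • v + y • w = 0 → x = 0 ∧ y = 0 := by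
    intro v w hv hw x y h
    have hy : y = 0 := by
      by_contra hy
      apply hw (-(y⁻¹ * x))
      have : y • w = -(x • v) := eq_neg_of_add_eq_zero_right h
      rw [neg_smul, mul_smul, ← smul_neg, ← this, smul_smul, inv_mul_cancel₀ hy, one_smul]
    subst hy
    refine ⟨?_, rfl⟩
    simpa [hv] using h
  have h12 : ∀ x y : ℝ, x • v₁ + y • v₂ = 0 → x = 0 ∧ y = 0 := by
    refine hindep hv₁ fun k hk => hne p₂ ?_
    have hk0 : k ≠ 0 := by
      rintro rfl
      exact hv₂ (by rw [hk, zero_smul])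
    refine Line.ofPointDir_eq_of_mem (c := k⁻¹) (Line.mem_ofPointDir.2 ⟨0, by simp⟩) ?_ hv₁
    rw [hk, smul_smul, inv_mul_cancel₀ hk0, one_smul]
  obtain ⟨n, hn, hn1, hn2⟩ := exists_linearMap_eq_zero v₁ v₂
  obtain ⟨q, hq1, hq2⟩ := exists_mem_of_not_parallel hcommon hskew hℓ₁ hℓ₂ h12
  have hconst : ∀ {p v : Space} {hv : v ≠ 0}, n v = 0 → ∀ x ∈ (Line.ofPointDir p v hv).points,
      ∀ y ∈ (Line.ofPointDir p v hv).points, n x = n y := by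
    intro p v hv hnv x hx y hy
    obtain ⟨r, rfl⟩ := Line.mem_ofPointDir.1 hx
    obtain ⟨t, rfl⟩ := Line.mem_ofPointDir.1 hy
    simp [hnv]
  refine ⟨n, hn, n q, fun ℓ hℓ x hx => ?_⟩
  obtain ⟨p₃, v₃, hv₃, rfl⟩ := ℓ.exists_eq_ofPointDir
  -- A third transversal parallel to the plane is nonparallel to one of the first two, meets it, and
  -- hence lies in the plane. One that is transverse to the plane meets both where it pierces the
  -- plane, so the three lines are concurrent at `r`.
  by_cases hn3 : n v₃ = 0
  · by_cases h13 : ∀ k : ℝ, v₃ ≠ k • v₁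
    · obtain ⟨r, hr1, hr3⟩ := exists_mem_of_not_parallel hcommon hskew hℓ₁ hℓ (hindep hv₁ h13)
      rw [hconst hn3 x hx r hr3, hconst hn1 r hr1 q hq1]
    · have h23 : ∀ k : ℝ, v₃ ≠ k • v₂ := by
        push Not at h13
        obtain ⟨k, hk⟩ := h13
        intro k' hk'
        have : k • v₁ + (-k') • v₂ = 0 := by
          rw [neg_smul, ← hk, ← hk', add_neg_cancel]
        obtain ⟨rfl, -⟩ := h12 _ _ this
        exact hv₃ (by rw [hk, zero_smul])
      obtain ⟨r, hr2, hr3⟩ := exists_mem_of_not_parallel hcommon hskew hℓ₂ hℓ (hindep hv₂ h23)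
      rw [hconst hn3 x hx r hr3, hconst hn2 r hr2 q hq2]
  · exfalso
    have h13 : ∀ k : ℝ, v₃ ≠ k • v₁ := by
      rintro k rfl
      simp [hn1] at hn3
    have h23 : ∀ k : ℝ, v₃ ≠ k • v₂ := by
      rintro k rfl
      simp [hn2] at hn3
    obtain ⟨r, hr1, hr3⟩ := exists_mem_of_not_parallel hcommon hskew hℓ₁ hℓ (hindep hv₁ h13)
    obtain ⟨r', hr2', hr3'⟩ := exists_mem_of_not_parallel hcommon hskew hℓ₂ hℓ (hindep hv₂ h23)
    have hnr : n r = n q := hconst hn1 r hr1 q hq1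
    have hnr' : n r' = n q := hconst hn2 r' hr2' q hq2
    obtain rfl : r = r' := by
      obtain ⟨t, rfl⟩ := Line.mem_ofPointDir.1 hr3
      obtain ⟨t', rfl⟩ := Line.mem_ofPointDir.1 hr3'
      have : (t - t') * n v₃ = 0 := by
        simp at hnr hnr'
        linarith
      have htt : t = t' := by linarith [(mul_eq_zero.1 this).resolve_right hn3]
      rw [htt]
    rw [Line.ofPointDir_eq_of_mem (c := 1) hr1 (one_smul ℝ v₁).symm hv₁] at hℓ₁
    rw [Line.ofPointDir_eq_of_mem (c := 1) hr2' (one_smul ℝ v₂).symm hv₂] at hℓ₂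
    rw [Line.ofPointDir_eq_of_mem (c := 1) hr3 (one_smul ℝ v₃).symm hv₃] at hℓ
    refine hcommon ⟨r, fun i => ?_⟩
    obtain ⟨x₁, hx1, hs1⟩ := hℓ₁ i
    obtain ⟨x₂, hx2, hs2⟩ := hℓ₂ i
    obtain ⟨x₃, hx3, hs3⟩ := hℓ i
    obtain ⟨α, rfl⟩ := Line.mem_ofPointDir.1 hx1
    obtain ⟨β, rfl⟩ := Line.mem_ofPointDir.1 hx2
    obtain ⟨γ, rfl⟩ := Line.mem_ofPointDir.1 hx3
    by_cases hγ : γ = 0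
    · simpa [hγ] using hs3
    obtain ⟨a, b, J, hab⟩ := hs i
    have hs1' := hs1
    rw [hab] at hs1' hs2 hs3
    obtain ⟨σ₁, -, e1⟩ := hs1'
    obtain ⟨σ₂, -, e2⟩ := hs2
    obtain ⟨σ₃, -, e3⟩ := hs3
    have f1 : (1 - σ₁) * n a + σ₁ * n b = n r := by simpa [hn1] using congrArg n e1
    have f2 : (1 - σ₂) * n a + σ₂ * n b = n r := by simpa [hn2] using congrArg n e2
    have f3 : (1 - σ₃) * n a + σ₃ * n b = n r + γ * n v₃ := by simpa using congrArg n e3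
    -- A segment meeting the third line away from `r` leaves the plane, so it meets the first two
    -- lines in the same point, which is `r`. Thus `r` would be common to all segments.
    have hba : n b - n a ≠ 0 := by
      intro h0
      have : γ * n v₃ = 0 := by
        have hb : n b = n a := by linarith
        rw [hb] at f1 f3
        linarith
      exact mul_ne_zero hγ hn3 this
    have hσ : σ₁ = σ₂ := by
      have : (σ₁ - σ₂) * (n b - n a) = 0 := by linarith
      linarith [(mul_eq_zero.1 this).resolve_right hba]
    have hαβ : α • v₁ + (-β) • v₂ = 0 := by
      have e : r + α • v₁ = r + β • v₂ := by rw [← e1, ← e2, hσ]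
      rw [neg_smul, add_left_cancel e, add_neg_cancel]
    obtain ⟨rfl, -⟩ := h12 _ _ hαβ
    simpa using hs1

theorem coveredByPieces_transversals [Fintype ι] [Nonempty ι] {s : ι → Set Space}
    (hs : ∀ i, IsLineSegment (s i)) : CoveredByPieces (transversals s) (Fintype.card ι) := by
  have hpos : 1 ≤ Fintype.card ι := Fintype.card_pos
  have hseg := fun i => (hs i).exists_eq_segmentOf
  by_cases hcommon : ∃ x, ∀ i, x ∈ s i
  · obtain ⟨x, hx⟩ := hcommon
    refine (coveredByPieces_of_common_point (fun i => ?_) hx).mono hpos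
    obtain ⟨a, b, J, hJ, -, h⟩ := hseg i
    rw [h, segmentOf]
    rintro _ ⟨r, hr, rfl⟩ _ ⟨r', hr', rfl⟩ w w' hw hw' hww
    refine ⟨w * r + w' * r', hJ hr hr' hw hw' hww, ?_⟩
    obtain rfl : w' = 1 - w := by linarith
    module
  by_cases hskew : ∀ i j, ∀ x ∈ s i, ∀ y ∈ s i, ∀ x' ∈ s j, ∀ y' ∈ s j,
      ¬ LinearIndependent ℝ ![y - x, y' - x', x' - x]
  · obtain ⟨n, hn, c, hplane⟩ := exists_plane_of_coplanar
      (fun i => let ⟨a, b, J, _, _, h⟩ := hseg i; ⟨a, b, J, h⟩) hcommon hskew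
    exact coveredByPieces_of_forall_subset_plane hseg hcommon hn hplane
  · push Not at hskew
    obtain ⟨i, j, x, hx, y, hy, x', hx', y', hy', hli⟩ := hskew
    choose a b J hJ _ hab using hseg
    obtain rfl : s = fun i => segmentOf (a i) (b i) (J i) := funext hab
    exact coveredByPieces_of_skew hJ hx hy hx' hy' hli

end

/-! ### Sharpness: segments on a hyperboloid -/

/-- A point of the coordinate axis. -/
noncomputable def axisPoint (t : ℝ) : Space := !₂[t, 0, 0]

/-- The point at height `z` of the line `x = -h z`, `h y = z - 1`, which belongs to one of the
rulings of the hyperboloid `x y = z (1 - z)`. -/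
noncomputable def rulingPoint (h z : ℝ) : Space := !₂[-(h * z), -(1 - z) / h, z]

theorem segment_axisPoint {α β : ℝ} (h : α ≤ β) :
    segment ℝ (axisPoint α) (axisPoint β) = axisPoint '' Set.Icc α β := by
  rw [segment_eq_image, ← segment_eq_Icc h, segment_eq_image, Set.image_image]
  refine Set.image_congr fun s _ => ?_
  ext i
  fin_cases i <;> simp [axisPoint]

theorem segment_rulingPoint (h : ℝ) {z z' : ℝ} (hz : z ≤ z') :
    segment ℝ (rulingPoint h z) (rulingPoint h z') = rulingPoint h '' Set.Icc z z' := by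
  rw [segment_eq_image, ← segment_eq_Icc hz, segment_eq_image, Set.image_image]
  refine Set.image_congr fun s _ => ?_
  ext i
  fin_cases i <;> simp [rulingPoint] <;> ring

/-- One segment on the axis, cutting out `[α, β]`, and `n - 1` segments on a ruling that cut out the
complements of the intervals of radius `δ` around `j + 1 / 2`. -/
noncomputable def gapSegments (n : ℕ) (α β δ : ℝ) (j : Fin n) : Set Space :=
  if (j : ℕ) = 0 then segment ℝ (axisPoint α) (axisPoint β) else
    segment ℝ (rulingPoint (j + 1 / 2) (1 - (j + 1 / 2) / δ))
      (rulingPoint (j + 1 / 2) (1 + (j + 1 / 2) / δ))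

/-- The parameters that survive the gaps. -/
def gapParameters (n : ℕ) (α β δ : ℝ) : Set ℝ :=
  {t | t ∈ Set.Icc α β ∧ ∀ j : ℕ, 1 ≤ j → j < n → δ ≤ |t - (j + 1 / 2)|}

section

variable {n : ℕ} {α β δ : ℝ}

theorem isLineSegment_gapSegments (j : Fin n) : IsLineSegment (gapSegments n α β δ j) := by
  unfold gapSegments
  split_ifs
  · exact ⟨_, _, Or.inl rfl⟩
  · exact ⟨_, _, Or.inl rfl⟩

theorem gapSegments_zero (hαβ : α ≤ β) {j : Fin n} (hj : (j : ℕ) = 0) :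
    gapSegments n α β δ j = axisPoint '' Set.Icc α β := by
  rw [gapSegments, if_pos hj, segment_axisPoint hαβ]

theorem gapSegments_pos (hδ : 0 < δ) {j : Fin n} (hj : (j : ℕ) ≠ 0) :
    gapSegments n α β δ j = rulingPoint (j + 1 / 2) ''
      Set.Icc (1 - (j + 1 / 2) / δ) (1 + (j + 1 / 2) / δ) := by
  have : (0 : ℝ) ≤ ((j : ℕ) + 1 / 2) / δ := by positivity
  rw [gapSegments, if_neg hj, segment_rulingPoint _ (by linarith)]

theorem gapSegments_injective (hαβ : α ≤ β) (hδ : 0 < δ) :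
    Function.Injective (gapSegments n α β δ) := by
  have hone : ∀ j : Fin n, (j : ℕ) ≠ 0 → rulingPoint (j + 1 / 2) 1 ∈ gapSegments n α β δ j := by
    intro j hj
    have : (0 : ℝ) ≤ ((j : ℕ) + 1 / 2) / δ := by positivity
    rw [gapSegments_pos hδ hj]
    exact ⟨1, ⟨by linarith, by linarith⟩, rfl⟩
  have hzero : ∀ j j' : Fin n, (j : ℕ) = 0 → (j' : ℕ) ≠ 0 →
      gapSegments n α β δ j ≠ gapSegments n α β δ j' := by
    intro j j' hj hj' h
    have := hone j' hj'
    rw [← h, gapSegments_zero hαβ hj] at this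
    obtain ⟨t, -, ht⟩ := this
    have := congrArg (fun x : Space => x 2) ht
    simp [axisPoint, rulingPoint] at this
  intro j j' h
  by_cases hj : (j : ℕ) = 0 <;> by_cases hj' : (j' : ℕ) = 0
  · exact Fin.ext (hj.trans hj'.symm)
  · exact absurd h (hzero j j' hj hj')
  · exact absurd h.symm (hzero j' j hj' hj)
  · have hm := hone j hj
    rw [h, gapSegments_pos hδ hj'] at hm
    obtain ⟨z, -, hz⟩ := hm
    have h2 := congrArg (fun x : Space => x 2) hz
    have h0 := congrArg (fun x : Space => x 0) hz
    simp [rulingPoint] at h2 h0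
    subst h2
    apply Fin.ext
    have : ((j' : ℕ) : ℝ) = (j : ℕ) := by linarith
    exact_mod_cast this.symm

/-- The bridges `(t, t⁻¹)` belong to the opposite ruling of the same hyperboloid, so they meet the
line of `h` except when `t = h`. -/
theorem rulingPoint_mem_bridge {t h z : ℝ} (ht : t ≠ 0) (hh : h ≠ 0) :
    rulingPoint h z ∈ (Line.bridge t t⁻¹).points ↔ z * (t - h) = t := by
  rw [Line.mem_bridge]
  simp [rulingPoint]
  constructor
  · rintro ⟨e, -⟩
    linarith
  · intro e
    refine ⟨by linarith, ?_⟩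
    field_simp
    linarith

/-- The lines through a point of the axis meeting two lines of the ruling. -/
theorem eq_bridge_of_mem {ℓ : Line} {t h h' z z' : ℝ} (ht : t ≠ 0) (hh : h ≠ 0) (hh' : h' ≠ 0)
    (hne : h ≠ h') (h0 : axisPoint t ∈ ℓ.points) (h1 : rulingPoint h z ∈ ℓ.points)
    (h2 : rulingPoint h' z' ∈ ℓ.points) : ℓ = Line.bridge t t⁻¹ := by
  have hnot : ∀ {k w : ℝ}, k ≠ 0 → rulingPoint k w ≠ axisPoint t := by
    intro k w hk he
    have e2 := congrArg (fun x : Space => x 2) he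
    have e0 := congrArg (fun x : Space => x 0) he
    simp [rulingPoint, axisPoint] at e2 e0
    rw [e2] at e0
    simp at e0
    exact ht e0.symm
  rw [Line.eq_ofPointDir_sub h0 h1 (sub_ne_zero.2 (hnot hh)), Line.mem_ofPointDir] at h2
  obtain ⟨r, hr⟩ := h2
  have e0 := congrArg (fun x : Space => x 0) hr
  have e1 := congrArg (fun x : Space => x 1) hr
  have e2 := congrArg (fun x : Space => x 2) hr
  simp [rulingPoint, axisPoint] at e0 e1 e2
  have e1' : (1 - z') * h = r * (1 - z) * h' := by
    field_simp at e1
    linarith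
  have key : (h - h') * (z' * (t - h') - t) = 0 := by
    linear_combination (-h') * e0 + (-t * h' - h * h') * e2 - t * e1'
  have hz' : z' * (t - h') = t := by
    linarith [(mul_eq_zero.1 key).resolve_left (sub_ne_zero.2 hne)]
  have h2 : rulingPoint h' z' ∈ ℓ.points := by
    rw [Line.eq_ofPointDir_sub h0 h1 (sub_ne_zero.2 (hnot hh)), Line.mem_ofPointDir]
    exact ⟨r, hr⟩
  refine Line.eq_of_mem (hnot hh') h2 h0 ((rulingPoint_mem_bridge ht hh').2 hz')
    (Line.mem_bridge.2 ?_)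
  simp [axisPoint]

/-- The meeting height satisfies `z - 1 = h / (t - h)` and escapes to infinity at `t = h`.
Truncating to `|z - 1| ≤ h / δ` therefore removes exactly the parameters at distance less than `δ`
from `h`. -/
theorem bridge_meets_ruling_iff {t h : ℝ} (ht : 0 < t) (hh : 0 < h) (hδ : 0 < δ) :
    ((Line.bridge t t⁻¹).points ∩ rulingPoint h '' Set.Icc (1 - h / δ) (1 + h / δ)).Nonempty ↔
      δ ≤ |t - h| := by
  have hiff : ∀ z, z * (t - h) = t → (z ∈ Set.Icc (1 - h / δ) (1 + h / δ) ↔ δ ≤ |t - h|) := by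
    intro z hz
    have hth : t - h ≠ 0 := by
      intro h0
      rw [h0] at hz
      simp at hz
      exact ht.ne hz
    have hz1 : z - 1 = h / (t - h) := by
      field_simp
      linarith
    have habs : |z - 1| = h / |t - h| := by rw [hz1, abs_div, abs_of_pos hh]
    have : z ∈ Set.Icc (1 - h / δ) (1 + h / δ) ↔ |z - 1| ≤ h / δ := by
      rw [abs_le, Set.mem_Icc]
      constructor <;> rintro ⟨_, _⟩ <;> constructor <;> linarith
    rw [this, habs]
    exact div_le_div_iff_of_pos_left hh (abs_pos.2 hth) hδ
  constructor
  · rintro ⟨_, hx, z, hz, rfl⟩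
    rw [rulingPoint_mem_bridge ht.ne' hh.ne'] at hx
    exact (hiff z hx).1 hz
  · intro hle
    have hth : t - h ≠ 0 := abs_pos.1 (hδ.trans_le hle)
    have hz : t / (t - h) * (t - h) = t := div_mul_cancel₀ _ hth
    exact ⟨_, (rulingPoint_mem_bridge ht.ne' hh.ne').2 hz, _, (hiff _ hz).2 hle, rfl⟩

/-- Segments `0`, `1` and `2` already force a transversal into the opposite ruling, which is where
`3 ≤ n` enters; every segment then only restricts `t`. -/
theorem transversals_gapSegments (hn : 3 ≤ n) (hα : 0 < α) (hαβ : α ≤ β) (hδ : 0 < δ) :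
    transversals (gapSegments n α β δ) =
      (fun t => Line.bridge t t⁻¹) '' gapParameters n α β δ := by
  ext ℓ
  constructor
  · intro hℓ
    obtain ⟨_, hx0, h0⟩ := hℓ ⟨0, by omega⟩
    obtain ⟨_, hx1, h1⟩ := hℓ ⟨1, by omega⟩
    obtain ⟨_, hx2, h2⟩ := hℓ ⟨2, by omega⟩
    rw [gapSegments_zero hαβ rfl] at h0
    rw [gapSegments_pos hδ one_ne_zero] at h1
    rw [gapSegments_pos hδ two_ne_zero] at h2
    obtain ⟨t, ht, rfl⟩ := h0
    obtain ⟨z, -, rfl⟩ := h1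
    obtain ⟨z', -, rfl⟩ := h2
    have htpos : 0 < t := hα.trans_le ht.1
    have hb := eq_bridge_of_mem htpos.ne' (by norm_num) (by norm_num) (by norm_num) hx0 hx1 hx2
    rw [hb] at hℓ ⊢
    refine ⟨t, ⟨ht, fun j hj hjn => ?_⟩, rfl⟩
    have := hℓ ⟨j, hjn⟩
    rw [gapSegments_pos hδ (by simp; omega)] at this
    exact (bridge_meets_ruling_iff htpos (by positivity) hδ).1 this
  · rintro ⟨t, ⟨ht, hgap⟩, rfl⟩ j
    have htpos : 0 < t := hα.trans_le ht.1
    by_cases hj : (j : ℕ) = 0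
    · rw [gapSegments_zero hαβ hj]
      exact ⟨axisPoint t, Line.mem_bridge.2 (by simp [axisPoint]), t, ht, rfl⟩
    · rw [gapSegments_pos hδ hj]
      exact (bridge_meets_ruling_iff htpos (by positivity) hδ).2 (hgap j (by omega) j.2)

theorem bridge_inv_injective : Function.Injective fun t : ℝ => Line.bridge t t⁻¹ := by
  intro t t' h
  have := congrArg (Line.coordAt 0 0) h
  simpa [Line.coordAt_zero_bridge] using this

theorem continuousOn_bridge_inv : ContinuousOn (fun t : ℝ => Line.bridge t t⁻¹) {0}ᶜ := by
  have hpair : ContinuousOn (fun t : ℝ => (t, t⁻¹)) {0}ᶜ :=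
    continuousOn_id.prodMk (continuousOn_inv₀ (G₀ := ℝ))
  have h := Line.continuous_bridge.comp_continuousOn hpair
  simpa only [Function.comp_def] using h

/-- With radius `1 / 2` the open gaps `(j, j + 1)` touch and leave only integers. The last gap ends
at `n`, so `k = n` is still reached. -/
theorem gapParameters_half {k : ℕ} (hkn : k ≤ n) :
    gapParameters n 1 k (1 / 2) = (fun i : ℕ => (i : ℝ)) '' Set.Icc 1 k := by
  ext t
  constructor
  · rintro ⟨⟨h1, h2⟩, hgap⟩
    have hfl := Nat.floor_le (show (0 : ℝ) ≤ t by linarith)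
    have hlt := Nat.lt_floor_add_one t
    have hj1 : 1 ≤ ⌊t⌋₊ := Nat.le_floor (by simpa using h1)
    have hjk : ⌊t⌋₊ ≤ k := by exact_mod_cast hfl.trans h2
    refine ⟨⌊t⌋₊, ⟨hj1, hjk⟩, le_antisymm hfl ?_⟩
    rcases lt_or_ge ⌊t⌋₊ n with hlt' | hge
    · have := hgap _ hj1 hlt'
      rcases le_abs.1 this with h | h <;> linarith
    · have : k = ⌊t⌋₊ := by omega
      rwa [← this]
  · rintro ⟨i, ⟨h1, h2⟩, rfl⟩
    refine ⟨⟨Nat.one_le_cast.2 h1, Nat.cast_le.2 h2⟩, fun j _ _ => ?_⟩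
    rcases le_or_gt i j with h | h
    · have : (i : ℝ) ≤ j := by exact_mod_cast h
      refine le_abs.2 (Or.inr ?_)
      dsimp only
      linarith
    · have : (j : ℝ) + 1 ≤ i := by exact_mod_cast h
      refine le_abs.2 (Or.inl ?_)
      dsimp only
      linarith

theorem mem_gapParameters_quarter {k : ℕ} (hkn : k ≤ n) {t : ℝ} :
    t ∈ gapParameters n (3 / 4) (k + 1 / 4) (1 / 4) ↔
      ∃ i : ℕ, i < k ∧ t ∈ Set.Icc ((i : ℝ) + 3 / 4) (i + 5 / 4) := by
  constructor
  · rintro ⟨⟨h1, h2⟩, hgap⟩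
    have hfl := Nat.floor_le (show (0 : ℝ) ≤ t + 1 / 2 by linarith)
    -- The integer nearest to `t` is the centre `i + 1` of the surviving interval.
    have hlt := Nat.lt_floor_add_one (t + 1 / 2)
    have hj1 : 1 ≤ ⌊t + 1 / 2⌋₊ := Nat.le_floor (by norm_num; linarith)
    obtain ⟨i, hi⟩ : ∃ i, ⌊t + 1 / 2⌋₊ = i + 1 := ⟨⌊t + 1 / 2⌋₊ - 1, by omega⟩
    rw [hi] at hfl hlt
    push_cast at hfl hlt
    have hik : i < k := by
      have : (i : ℝ) < k := by linarith
      exact_mod_cast this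
    refine ⟨i, hik, ?_, ?_⟩
    · by_contra! hcon
      rcases Nat.eq_zero_or_pos i with rfl | hpos
      · norm_num at hcon
        linarith
      · rcases le_abs.1 (hgap i hpos (by omega)) with h | h <;> linarith
    · by_contra! hcon
      rcases lt_or_ge (i + 1) n with hin | hin
      · have := hgap (i + 1) (by omega) hin
        push_cast at this
        rcases le_abs.1 this with h | h <;> linarith
      · have : k = i + 1 := by omega
        rw [this] at h2
        push_cast at h2
        linarith
  · rintro ⟨i, hi, h1, h2⟩
    have hik : (i : ℝ) + 1 ≤ k := by exact_mod_cast hi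
    have hi0 : (0 : ℝ) ≤ i := Nat.cast_nonneg i
    refine ⟨⟨by linarith, by linarith⟩, fun j _ _ => ?_⟩
    rcases lt_or_ge i j with h | h
    · have : (i : ℝ) + 1 ≤ j := by exact_mod_cast h
      exact le_abs.2 (Or.inr (by linarith))
    · have : (j : ℝ) ≤ i := by exact_mod_cast h
      exact le_abs.2 (Or.inl (by linarith))

theorem exists_ncard_transversals (hn : 3 ≤ n) {k : ℕ} (hk : k ≤ n) :
    ∃ s : Fin n → Set Space, Function.Injective s ∧ (∀ i, IsLineSegment (s i)) ∧
      (transversals s).Finite ∧ (transversals s).ncard = k := by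
  rcases Nat.eq_zero_or_pos k with rfl | hpos
  -- The axis segment shrinks to the centre of the first gap, so no parameter survives.
  · refine ⟨gapSegments n (3 / 2) (3 / 2) (1 / 2), gapSegments_injective le_rfl (by norm_num),
      isLineSegment_gapSegments, ?_⟩
    have : gapParameters n (3 / 2) (3 / 2) (1 / 2) = ∅ := by
      rw [Set.eq_empty_iff_forall_notMem]
      rintro t ⟨⟨h1, h2⟩, hgap⟩
      have := hgap 1 le_rfl (by omega)
      rcases le_abs.1 this with h | h <;> norm_num at h <;> linarith
    rw [transversals_gapSegments hn (by norm_num) le_rfl (by norm_num), this]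
    simp
  · have hk1 : (1 : ℝ) ≤ k := by exact_mod_cast hpos
    refine ⟨gapSegments n 1 k (1 / 2), gapSegments_injective hk1 (by norm_num),
      isLineSegment_gapSegments, ?_⟩
    rw [transversals_gapSegments hn (by norm_num) hk1 (by norm_num), gapParameters_half hk]
    refine ⟨((Set.finite_Icc 1 k).image _).image _, ?_⟩
    rw [Set.ncard_image_of_injective _ bridge_inv_injective,
      Set.ncard_image_of_injective _ Nat.cast_injective, ← Finset.coe_Icc, Set.ncard_coe_finset]
    simp

theorem exists_hasComponents_transversals (hn : 3 ≤ n) {k : ℕ} (hk1 : 1 ≤ k) (hk : k ≤ n) :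
    ∃ s : Fin n → Set Space, Function.Injective s ∧ (∀ i, IsLineSegment (s i)) ∧
      (transversals s).Infinite ∧ HasComponents (transversals s) k := by
  have hk1' : (1 : ℝ) ≤ k := by exact_mod_cast hk1
  have hle : (3 / 4 : ℝ) ≤ k + 1 / 4 := by linarith
  refine ⟨gapSegments n (3 / 4) (k + 1 / 4) (1 / 4), gapSegments_injective hle (by norm_num),
    isLineSegment_gapSegments, ?_⟩
  rw [transversals_gapSegments hn (by norm_num) hle (by norm_num)]
  set K := gapParameters n (3 / 4) (k + 1 / 4) (1 / 4) with hK
  set f : ℝ → Line := fun t => Line.bridge t t⁻¹ with hf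
  have hcoord : ∀ t, Line.coordAt 0 0 (f t) = t := fun t => Line.coordAt_zero_bridge _ _
  have hfc : ContinuousOn f K := continuousOn_bridge_inv.mono fun x hx =>
    ((show (0 : ℝ) < 3 / 4 by norm_num).trans_le hx.1.1).ne'
  constructor
  · refine Set.Infinite.image bridge_inv_injective.injOn ?_
    refine (Set.Icc_infinite (show (3 / 4 : ℝ) < 5 / 4 by norm_num)).mono fun t ht => ?_
    exact (mem_gapParameters_quarter hk).2 ⟨0, hk1, by simpa using ht⟩
  have hmem : ∀ ℓ : f '' K, ∃ i : Fin k,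
      Line.coordAt 0 0 ℓ.1 ∈ Set.Icc ((i : ℕ) + 3 / 4 : ℝ) ((i : ℕ) + 5 / 4) := by
    rintro ⟨_, t, ht, rfl⟩
    obtain ⟨i, hi, hti⟩ := (mem_gapParameters_quarter hk).1 ht
    exact ⟨⟨i, hi⟩, by rw [hcoord]; exact hti⟩
  -- The surviving intervals are disjoint, so the index of the interval containing the coordinate is
  -- a continuous map to `Fin k` with path-connected fibres.
  choose r hr using hmem
  have hruniq : ∀ (ℓ : f '' K) (i : Fin k),
      Line.coordAt 0 0 ℓ.1 ∈ Set.Icc ((i : ℕ) + 3 / 4 : ℝ) ((i : ℕ) + 5 / 4) → r ℓ = i := by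
    intro ℓ i hi
    have h := hr ℓ
    have h1 : ((r ℓ : ℕ) : ℝ) < (i : ℕ) + 1 := by linarith [h.1, hi.2]
    have h2 : ((i : ℕ) : ℝ) < (r ℓ : ℕ) + 1 := by linarith [h.2, hi.1]
    have h1' : (r ℓ : ℕ) < i + 1 := by exact_mod_cast h1
    have h2' : (i : ℕ) < r ℓ + 1 := by exact_mod_cast h2
    exact Fin.ext (by omega)
  have hcont : Continuous fun ℓ : f '' K => Line.coordAt 0 0 ℓ.1 := by
    refine continuousOn_iff_continuous_domRestrict.1 ((Line.continuousOn_coordAt 0 0).mono ?_)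
    rintro _ ⟨t, -, rfl⟩
    exact Line.bridge_mem_slanted _ _
  have hrc : Continuous r := by
    rw [continuous_iff_isClosed]
    intro C _
    have : r ⁻¹' C = ⋃ i ∈ C, (fun ℓ : f '' K => Line.coordAt 0 0 ℓ.1) ⁻¹'
        Set.Icc ((i : ℕ) + 3 / 4 : ℝ) ((i : ℕ) + 5 / 4) := by
      ext ℓ
      simp only [Set.mem_iUnion, Set.mem_preimage, exists_prop]
      constructor
      · intro h
        exact ⟨r ℓ, h, hr ℓ⟩
      · rintro ⟨i, hi, h⟩
        rwa [hruniq ℓ i h]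
    rw [this]
    exact Set.Finite.isClosed_biUnion (Set.toFinite _) fun i _ => isClosed_Icc.preimage hcont
  refine card_components_of_fibers r hrc ?_ ?_
  · intro i
    have hi : ((i : ℕ) + 1 : ℝ) ∈ K :=
      (mem_gapParameters_quarter hk).2 ⟨i, i.2, by constructor <;> linarith⟩
    refine ⟨⟨f ((i : ℕ) + 1), _, hi, rfl⟩, hruniq _ _ ?_⟩
    rw [hcoord]
    constructor <;> linarith
  · rintro ⟨_, t, ht, rfl⟩ ⟨_, t', ht', rfl⟩ heq
    have h1 := hr ⟨f t, t, ht, rfl⟩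
    have h2 := hr ⟨f t', t', ht', rfl⟩
    rw [← heq, hcoord] at h2
    rw [hcoord] at h1
    generalize r ⟨f t, t, ht, rfl⟩ = i at h1 h2
    have hsub : Set.Icc ((i : ℕ) + 3 / 4 : ℝ) ((i : ℕ) + 5 / 4) ⊆ K := fun x hx =>
      (mem_gapParameters_quarter hk).2 ⟨i, i.2, hx⟩
    have hjoin : JoinedIn K t t' :=
      (((convex_Icc _ _).isPathConnected ⟨t, h1⟩).joinedIn t h1 t' h2).mono hsub
    exact (joinedIn_iff_joined _ _).1 (hjoin.map_continuousOn hfc)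

end

theorem theorem1 (n : ℕ) (hn : 3 ≤ n) :
    (∀ s : Fin n → Set Space, (∀ i, IsLineSegment (s i)) →
      ((transversals s).Finite ∧ (transversals s).ncard ≤ n) ∨
      ((transversals s).Infinite ∧ ∃ k : ℕ, 1 ≤ k ∧ k ≤ n ∧ HasComponents (transversals s) k)) ∧
    (∀ k : ℕ, k ≤ n →
      ∃ s : Fin n → Set Space, Function.Injective s ∧ (∀ i, IsLineSegment (s i)) ∧
        (transversals s).Finite ∧ (transversals s).ncard = k) ∧
    (∀ k : ℕ, 1 ≤ k → k ≤ n →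
      ∃ s : Fin n → Set Space, Function.Injective s ∧ (∀ i, IsLineSegment (s i)) ∧
        (transversals s).Infinite ∧ HasComponents (transversals s) k) := by
  have : Nonempty (Fin n) := ⟨⟨0, by omega⟩⟩
  refine ⟨fun s hs => ?_, fun k hk => exists_ncard_transversals hn hk,
    fun k hk1 hk => exists_hasComponents_transversals hn hk1 hk⟩
  have h := coveredByPieces_transversals hs
  rw [Fintype.card_fin] at h
  exact h.finite_or_hasComponents
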